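/- Let $d\ge 1$, let $|n|$ denote the Euclidean norm of $n\in\mathbb Z^d$, and let $\delta_1,\dots,\delta_d$ be the standard basis of $\mathbb Z^d$. For $V:\mathbb Z^d\to\mathbb R$ let $H_V=-\Delta+V$ be the discrete Schrödinger operator in $\ell^2(\mathbb Z^d)$, where $$(-\Delta\psi)_n=\sum_{m\in\mathbb Z^d,\ |m-n|=1}(\psi_n-\psi_m),$$ with domain $\{\psi\in\ell^2(\mathbb Z^d): V\psi\in\ell^2(\mathbb Z^d)\}$. Denote by $\sigma$, $\sigma_{\rm p}$, $\sigma_{\rm ess}$ the spectrum, the set of eigenvalues and the essential spectrum (the spectrum without its isolated points that are eigenvalues of finite multiplicity). If $\inf\sigma(H_V)=0$, then $H_V$ is called critical at $0$ if, for every $W:\mathbb Z^d\to[0,\infty)$ whose multiplication operator is compact on $\ell^2(\mathbb Z^d)$, $\inf\sigma(H_V-W)=0$ implies $W=0$. Put $\log_0x=x$ and $\log_{k+1}x=\log(\log_kx)$ (natural logarithm), wherever defined. **Theorem.** Assume $\inf\sigma(H_V)=\inf\sigma_{\rm ess}(H_V)=0$ and that $H_V$ is critical at $0$. 1. If there exist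 an integer $s\ge0$ and $\varepsilon>0$ such that $$V_n\ \ge\ -2d+\sum_{j=1}^d\ \sum_{m\in\{n+\delta_j,\,n-\delta_j\}}\left(\frac{|n|}{|m|}\right)^{d/2}\left(\prod_{i=1}^s\sqrt{\frac{\log_i|n|}{\log_i|m|}}\right)\left(\frac{\log_s|n|}{\log_s|m|}\right)^{\varepsilon}$$ for all $n\in\mathbb Z^d$ with $|n|$ sufficiently large, then $0\in\sigma_{\rm p}(H_V)$. (With $b_n=|n|^{-d/2}\big(\prod_{i=1}^s(\log_i|n|)^{-1/2}\big)(\log_s|n|)^{-\varepsilon}$, the right-hand side is $(\Delta b)_n/b_n$ for $|n|$ large.) 2. In particular, if there exist an integer $s\ge0$ and $\varepsilon>0$ such that $$V_n\ \ge\ \frac{d(4-d)}{4|n|^2}+\frac1{|n|^2}\sum_{j=1}^s\prod_{k=1}^j\frac1{\log_k|n|}+\frac{\varepsilon}{|n|^2}\prod_{k=1}^s\frac1{\log_k|n|}$$ for all $n\in\mathbb Z^d$ with $|n|$ sufficiently large, then $0\in\sigma_{\rm p}(H_V)$. -/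

import Mathlib

open scoped ENNReal

noncomputable section

namespace LatticeSchrodinger

/-! ### Spectral notions for an unbounded operator given on a subspace of a Banach space -/

section Spectral

variable {E : Type*} [NormedAddCommGroup E] [NormedSpace ℂ E]

/-- The resolvent set of `T`: those `z` for which `T - z` has an everywhere defined bounded
two-sided inverse `R` with values in the domain of `T`. -/
def resolventSet (T : E →ₗ.[ℂ] E) : Set ℂ :=
  {z | ∃ R : E →L[ℂ] E,
    (∀ φ : E, ∃ h : R φ ∈ T.domain, T ⟨R φ, h⟩ - z • R φ = φ) ∧
    (∀ ψ : T.domain, R (T ψ - z • (ψ : E)) = (ψ : E))}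

/-- The spectrum of `T`. -/
def opSpectrum (T : E →ₗ.[ℂ] E) : Set ℂ := (resolventSet T)ᶜ

/-- The kernel of `T - z`, as a subspace of the domain of `T`. -/
def eigenspace (T : E →ₗ.[ℂ] E) (z : ℂ) : Submodule ℂ T.domain :=
  LinearMap.ker (T.toFun - z • T.domain.subtype)

/-- The point spectrum of `T`: the set of its eigenvalues. -/
def pointSpectrum (T : E →ₗ.[ℂ] E) : Set ℂ :=
  {z | ∃ ψ : T.domain, (ψ : E) ≠ 0 ∧ T ψ = z • (ψ : E)}

/-- The discrete spectrum of `T`: eigenvalues of finite multiplicity that are isolated points of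
the spectrum. -/
def discreteSpectrum (T : E →ₗ.[ℂ] E) : Set ℂ :=
  {z | z ∈ pointSpectrum T ∧ FiniteDimensional ℂ (eigenspace T z) ∧
    ∃ r : ℝ, 0 < r ∧ ∀ w ∈ opSpectrum T, ‖w - z‖ < r → w = z}

/-- The essential spectrum (of a self-adjoint operator): the part of the spectrum that is not
discrete. -/
def essSpectrum (T : E →ₗ.[ℂ] E) : Set ℂ := opSpectrum T \ discreteSpectrum T

/-- `inf S = a` for the real points of `S`. It is used for the spectrum and the essential spectrum
of a self-adjoint operator, all of whose points are real. In particular `S` has real points and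
they are bounded from below. -/
def HasInf (S : Set ℂ) (a : ℝ) : Prop := IsGLB {x : ℝ | (x : ℂ) ∈ S} a

end Spectral

/-! ### Discrete Schrödinger operators -/

/-- The Hilbert space `ℓ²(ℤᵈ)` of complex square-summable functions on the lattice. -/
abbrev L2 (d : ℕ) : Type := lp (fun _ : Fin d → ℤ => ℂ) 2

/-- The `j`-th standard basis vector of `ℤᵈ`. -/
def basisVec {d : ℕ} (j : Fin d) : Fin d → ℤ := Pi.single j 1

/-- The Euclidean norm of a lattice point. -/
def latticeNorm {d : ℕ} (n : Fin d → ℤ) : ℝ := √(∑ j, (n j : ℝ) ^ 2)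

/-- The positive Laplacian `(-Δψ)_n = ∑_{|m - n| = 1} (ψ_n - ψ_m)`; the lattice points at Euclidean
distance one from `n` are the `2d` points `n ± δ_j`. -/
def negLaplacian {d : ℕ} (ψ : (Fin d → ℤ) → ℂ) (n : Fin d → ℤ) : ℂ :=
  ∑ j, ((ψ n - ψ (n + basisVec j)) + (ψ n - ψ (n - basisVec j)))

theorem memℓp_shift {d : ℕ} {ψ : (Fin d → ℤ) → ℂ} (hψ : Memℓp ψ 2) (a : Fin d → ℤ) :
    Memℓp (fun n => ψ (n + a)) 2 := by
  have h2 : 0 < (2 : ℝ≥0∞).toReal := by norm_num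
  rw [memℓp_gen_iff h2] at hψ ⊢
  exact hψ.comp_injective (add_left_injective a)

theorem memℓp_negLaplacian {d : ℕ} {ψ : (Fin d → ℤ) → ℂ} (hψ : Memℓp ψ 2) :
    Memℓp (negLaplacian ψ) 2 := by
  unfold negLaplacian
  refine Memℓp.finsetSum (E := fun _ : Fin d → ℤ => ℂ) Finset.univ (fun j _ => ?_)
  have h1 := memℓp_shift hψ (basisVec j)
  have h2 := memℓp_shift hψ (-basisVec j)
  simp only [← sub_eq_add_neg] at h2
  exact (hψ.sub h1).add (hψ.sub h2)

/-- The maximal domain of multiplication by `V`. -/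
def potentialDomain {d : ℕ} (V : (Fin d → ℤ) → ℝ) : Submodule ℂ (L2 d) where
  carrier := {ψ | Memℓp (fun n => (V n : ℂ) * ψ n) 2}
  zero_mem' := by
    have h : Memℓp (0 : (Fin d → ℤ) → ℂ) 2 := zero_memℓp
    change Memℓp (fun n => (V n : ℂ) * ((0 : L2 d) n)) 2
    convert h using 1
    funext n
    simp
  add_mem' := by
    intro ψ φ hψ hφ
    have h := Memℓp.add hψ hφ
    change Memℓp (fun n => (V n : ℂ) * ((ψ + φ : L2 d) n)) 2
    convert h using 1
    funext n
    simp [mul_add]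
  smul_mem' := by
    intro c ψ hψ
    have h := Memℓp.const_smul hψ c
    change Memℓp (fun n => (V n : ℂ) * ((c • ψ : L2 d) n)) 2
    convert h using 1
    funext n
    simp [mul_left_comm]

/-- The discrete Schrödinger operator `H_V = -Δ + V` in `ℓ²(ℤᵈ)`, with domain the maximal domain
of the multiplication operator `V`. -/
def schrodinger {d : ℕ} (V : (Fin d → ℤ) → ℝ) : L2 d →ₗ.[ℂ] L2 d where
  domain := potentialDomain V
  toFun :=
    { toFun := fun ψ =>
        ⟨fun n => negLaplacian (ψ : L2 d) n + (V n : ℂ) * (ψ : L2 d) n,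
          (memℓp_negLaplacian (lp.memℓp (ψ : L2 d))).add ψ.2⟩
      map_add' := by
        intro ψ φ
        ext n
        simp only [negLaplacian, Submodule.coe_add, lp.coeFn_add, Pi.add_apply]
        rw [add_add_add_comm, ← Finset.sum_add_distrib, ← mul_add]
        congr 1
        refine Finset.sum_congr rfl fun j _ => ?_
        ring
      map_smul' := by
        intro c ψ
        ext n
        simp only [negLaplacian, Submodule.coe_smul, lp.coeFn_smul, Pi.smul_apply, smul_eq_mul,
          RingHom.id_apply]
        rw [mul_add, Finset.mul_sum, mul_left_comm]
        congr 1
        refine Finset.sum_congr rfl fun j _ => ?_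
        ring }

/-- The multiplication operator by `W` is a compact operator on `ℓ²(ℤᵈ)`. -/
def IsCompactPotential {d : ℕ} (W : (Fin d → ℤ) → ℝ) : Prop :=
  ∃ T : L2 d →L[ℂ] L2 d, (∀ ψ n, T ψ n = (W n : ℂ) * ψ n) ∧ IsCompactOperator T

/-- `H_V` is critical (from below) at `a = inf σ(H_V)`: whenever `W ≥ 0` is a compact
multiplication operator and `inf σ(H_V - W) = a`, then `W = 0`. -/
def IsCriticalAt {d : ℕ} (V : (Fin d → ℤ) → ℝ) (a : ℝ) : Prop :=
  HasInf (opSpectrum (schrodinger V)) a ∧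
  ∀ W : (Fin d → ℤ) → ℝ, (∀ n, 0 ≤ W n) → IsCompactPotential W →
    HasInf (opSpectrum (schrodinger (fun n => V n - W n))) a → ∀ n, W n = 0

/-! ### The comparison bounds -/

/-- The `k`-fold iterated natural logarithm, with `iterLog 0 x = x`. -/
def iterLog (k : ℕ) (x : ℝ) : ℝ := Real.log^[k] x

/-- `(|n|/|m|)^{d/2} ∏_{i=1}^s √(log_i|n| / log_i|m|) (log_s|n| / log_s|m|)^ε`. -/
def weightRatio {d : ℕ} (s : ℕ) (ε : ℝ) (n m : Fin d → ℤ) : ℝ :=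
  (latticeNorm n / latticeNorm m) ^ ((d : ℝ) / 2) *
    (∏ i ∈ Finset.Icc 1 s, √(iterLog i (latticeNorm n) / iterLog i (latticeNorm m))) *
    (iterLog s (latticeNorm n) / iterLog s (latticeNorm m)) ^ ε

/-- The general lower bound
`-2d + ∑_j weightRatio(n, n + δ_j) + ∑_j weightRatio(n, n - δ_j)`. -/
def generalBound {d : ℕ} (s : ℕ) (ε : ℝ) (n : Fin d → ℤ) : ℝ :=
  -2 * (d : ℝ) + ∑ j, weightRatio s ε n (n + basisVec j) +
    ∑ j, weightRatio s ε n (n - basisVec j)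

/-- The explicit lower bound
`d(4-d)/(4|n|²) + |n|⁻² ∑_{j=1}^s ∏_{k=1}^j 1/log_k|n| + ε|n|⁻² ∏_{k=1}^s 1/log_k|n|`. -/
def explicitBound {d : ℕ} (s : ℕ) (ε : ℝ) (n : Fin d → ℤ) : ℝ :=
  (d : ℝ) * (4 - (d : ℝ)) / (4 * latticeNorm n ^ 2) +
    1 / latticeNorm n ^ 2 *
      (∑ j ∈ Finset.Icc 1 s, ∏ k ∈ Finset.Icc 1 j, 1 / iterLog k (latticeNorm n)) +
    ε / latticeNorm n ^ 2 * (∏ k ∈ Finset.Icc 1 s, 1 / iterLog k (latticeNorm n))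

end LatticeSchrodinger

end

/-!
The proof compares an approximate ground state of `H_V` with the explicit function
`b = |n|^{-d/2} ∏_{i=1}^s (log_i |n|)^{-1/2} (log_s |n|)^{-ε}` (`decay`). The lower bound on `V` says
that `b` is a supersolution near infinity, `(-Δ + V) b ≥ 0`, and `b` is square summable: in the
variable `z = log |n|`, the mass of a dyadic shell is a derivative, so its sum telescopes
(`summable_decay_sq`).

Spectral theory enters through one fact (`hasInf_opSpectrum_iff`): when the quadratic form of `H_V`
is bounded from below, the bottom of the spectrum is its greatest lower bound. Hence `H_V ≥ 0`, and
criticality, applied to small multiples of the indicator function of a finite set `K`, yields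
functions `φ` with `∑_K |φ|² = 1` and arbitrarily small form (`IsCriticalAt.exists_form_lt`).
The form does not increase when `φ` is replaced by `|φ|` (`form_norm_le`), nor when `|φ|` is cut off
at a large multiple of `b` outside `K` (`form_min_le`). By the Cauchy–Schwarz inequality for the
form, the resulting functions solve `(-Δ + V) g = 0` up to an error that tends to zero at every
point; they lie between `0` and `C b`, so a subsequence converges pointwise to a solution that is
square summable, and nonzero since it is normalized on `K`
(`IsCriticalAt.zero_mem_pointSpectrum`).

For the explicit lower bound it remains to see that it dominates `Δb / b` near infinity for a
smaller `ε` (`exists_generalBound_le_explicitBound`). With `a = d/2 + A`, where `A` is the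
derivative of `½ ∑_{i=1}^s log_i z + ε log_s z` at `z = log |n|`, a second order expansion gives
`Δb / b ≤ |n|⁻² (a² - (d - 2) a + O(z⁻²)) + O(|n|⁻³)`, and
`a² - (d - 2) a = d (4 - d) / 4 + 2 A + A²`. The error terms are negligible because `z⁻²` is of
smaller order than `∏_{i < s} 1 / log_i z`.
-/

noncomputable section

namespace LatticeSchrodinger

open Filter Topology

/-! ### Quadratic forms of symmetric operators -/

section Form

variable {E : Type*} [NormedAddCommGroup E] [InnerProductSpace ℂ E]

/-- The quadratic form of `T` is bounded from below by `a`: `a ‖φ‖² ≤ Re ⟪φ, T φ⟫` on the domain. -/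
def FormBound (T : E →ₗ.[ℂ] E) (a : ℝ) : Prop :=
  ∀ φ : T.domain, a * ‖(φ : E)‖ ^ 2 ≤ (inner ℂ (φ : E) (T φ)).re

theorem form_re_symm {T : E →ₗ.[ℂ] E} (hT : T.IsFormalAdjoint T) (φ ψ : T.domain) :
    (inner ℂ (φ : E) (T ψ)).re = (inner ℂ (ψ : E) (T φ)).re := by
  rw [← hT φ ψ]
  exact inner_re_symm (𝕜 := ℂ) (T φ) (ψ : E)

/-- Expansion of the quadratic form of a symmetric operator along a real line. -/
theorem form_add_smul {T : E →ₗ.[ℂ] E} (hT : T.IsFormalAdjoint T) (φ ψ : T.domain) (t : ℝ) :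
    (inner ℂ ((φ + (t : ℂ) • ψ : T.domain) : E) (T (φ + (t : ℂ) • ψ))).re =
      (inner ℂ (φ : E) (T φ)).re + 2 * t * (inner ℂ (ψ : E) (T φ)).re +
        t ^ 2 * (inner ℂ (ψ : E) (T ψ)).re := by
  have h := form_re_symm hT φ ψ
  simp only [LinearPMap.map_add, LinearPMap.map_smul, Submodule.coe_add, Submodule.coe_smul,
    inner_add_left, inner_add_right, inner_smul_left, inner_smul_right, Complex.add_re,
    Complex.conj_ofReal, Complex.re_ofReal_mul]
  rw [h]
  ring

/-- The Cauchy–Schwarz inequality for the nonnegative form of `T - a`. -/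
theorem FormBound.cauchySchwarz {T : E →ₗ.[ℂ] E} (hT : T.IsFormalAdjoint T) {a : ℝ}
    (h : FormBound T a) (φ ψ : T.domain) :
    (inner ℂ (ψ : E) (T φ - (a : ℂ) • (φ : E))).re ^ 2 ≤
      (inner ℂ (φ : E) (T φ - (a : ℂ) • (φ : E))).re *
        (inner ℂ (ψ : E) (T ψ - (a : ℂ) • (ψ : E))).re := by
  have key : ∀ t : ℝ, 0 ≤ (inner ℂ (ψ : E) (T ψ - (a : ℂ) • (ψ : E))).re * (t * t) +
      (2 * (inner ℂ (ψ : E) (T φ - (a : ℂ) • (φ : E))).re) * t +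
      (inner ℂ (φ : E) (T φ - (a : ℂ) • (φ : E))).re := by
    intro t
    have h1 := h (φ + (t : ℂ) • ψ)
    rw [form_add_smul hT] at h1
    have h2 : ‖((φ + (t : ℂ) • ψ : T.domain) : E)‖ ^ 2 =
        ‖(φ : E)‖ ^ 2 + 2 * t * (inner ℂ (ψ : E) (φ : E)).re + t ^ 2 * ‖(ψ : E)‖ ^ 2 := by
      have h3 := norm_add_sq (𝕜 := ℂ) (φ : E) ((t : ℂ) • (ψ : E))
      have h4 : (inner ℂ (φ : E) (ψ : E)).re = (inner ℂ (ψ : E) (φ : E)).re :=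
        inner_re_symm (𝕜 := ℂ) _ _
      simp only [inner_smul_right, RCLike.re_to_complex, Complex.re_ofReal_mul, norm_smul,
        mul_pow, h4, Complex.norm_real, Real.norm_eq_abs, sq_abs] at h3
      rw [Submodule.coe_add, Submodule.coe_smul, h3]
      ring
    have h5 : ∀ χ : E, (inner ℂ χ χ).re = ‖χ‖ ^ 2 := fun χ => by
      rw [inner_self_eq_norm_sq_to_K]; norm_cast
    rw [h2] at h1
    simp only [inner_sub_right, inner_smul_right, Complex.sub_re, Complex.re_ofReal_mul, h5]
    nlinarith [h1]
  have := discrim_le_zero key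
  unfold discrim at this
  nlinarith [this]

/-- The greatest lower bound of the form cannot be a regular value: if `a` is a lower bound of the
form and lies in the resolvent set, the resolvent `R` at `a` is a nonnegative bounded operator, so
that `‖R η‖² ≤ ‖R‖ Re ⟪R η, η⟫`, and this improves the lower bound `a` by `1 / ‖R‖`. -/
theorem FormBound.exists_gt_of_notMem_opSpectrum {T : E →ₗ.[ℂ] E} (hT : T.IsFormalAdjoint T)
    {a : ℝ} (h : FormBound T a) (ha : (a : ℂ) ∉ opSpectrum T) : ∃ b, a < b ∧ FormBound T b := by
  rw [opSpectrum, Set.mem_compl_iff, not_not] at ha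
  obtain ⟨R, hR, hL⟩ := ha
  have hpos : (0 : ℝ) < ‖R‖ + 1 := by positivity
  refine ⟨a + 1 / (‖R‖ + 1), by simp only [lt_add_iff_pos_right]; positivity, fun φ => ?_⟩
  set q : ℝ := (inner ℂ (φ : E) (T φ - (a : ℂ) • (φ : E))).re with hq
  obtain ⟨hdom, hRR⟩ := hR (φ : E)
  have hcs := h.cauchySchwarz hT φ ⟨R (φ : E), hdom⟩
  simp only [hRR] at hcs
  have hself : ∀ χ : E, (inner ℂ χ χ).re = ‖χ‖ ^ 2 := fun χ => by
    rw [inner_self_eq_norm_sq_to_K]; norm_cast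
  have e1 : (inner ℂ (R (φ : E)) (T φ - (a : ℂ) • (φ : E))).re = ‖(φ : E)‖ ^ 2 := by
    -- `⟪R φ, (T - a) φ⟫ = ⟪(T - a) R φ, φ⟫ = ‖φ‖²` by symmetry.
    have h1 := hT ⟨R (φ : E), hdom⟩ φ
    simp only at h1
    have h2 : T ⟨R (φ : E), hdom⟩ = (φ : E) + (a : ℂ) • R (φ : E) := by
      exact sub_eq_iff_eq_add.1 hRR
    rw [inner_sub_right, ← h1, h2, inner_add_left, inner_smul_left, inner_smul_right,
      Complex.conj_ofReal, add_sub_cancel_right, hself]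
  have hqn : 0 ≤ q := by
    have := h φ
    simp only [hq, inner_sub_right, inner_smul_right, Complex.sub_re, Complex.re_ofReal_mul, hself]
    linarith
  have e2 : (inner ℂ (R (φ : E)) (φ : E)).re ≤ (‖R‖ + 1) * ‖(φ : E)‖ ^ 2 := by
    calc (inner ℂ (R (φ : E)) (φ : E)).re ≤ ‖R (φ : E)‖ * ‖(φ : E)‖ :=
          (Complex.re_le_norm _).trans (norm_inner_le_norm _ _)
      _ ≤ (‖R‖ * ‖(φ : E)‖) * ‖(φ : E)‖ := by gcongr; exact R.le_opNorm _
      _ ≤ (‖R‖ + 1) * ‖(φ : E)‖ ^ 2 := by nlinarith [sq_nonneg ‖(φ : E)‖]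
  rw [e1] at hcs
  have e3 : ‖(φ : E)‖ ^ 2 ≤ (‖R‖ + 1) * q := by
    rcases eq_or_ne (‖(φ : E)‖ ^ 2) 0 with h0 | h0
    · rw [h0]; positivity
    · have hp : 0 < ‖(φ : E)‖ ^ 2 := lt_of_le_of_ne (sq_nonneg _) h0.symm
      have : (‖(φ : E)‖ ^ 2) ^ 2 ≤ q * ((‖R‖ + 1) * ‖(φ : E)‖ ^ 2) :=
        hcs.trans (mul_le_mul_of_nonneg_left e2 hqn)
      nlinarith [this]
  have e4 : (inner ℂ (φ : E) (T φ)).re = q + a * ‖(φ : E)‖ ^ 2 := by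
    simp only [hq, inner_sub_right, inner_smul_right, Complex.sub_re, Complex.re_ofReal_mul, hself]
    ring
  rw [e4, add_mul, add_comm]
  gcongr
  rw [div_mul_eq_mul_div, one_mul, div_le_iff₀ hpos]
  linarith

end Form

/-! ### The Schrödinger operator as a symmetric operator -/

section Operator

variable {d : ℕ}

/-- The translate `n ↦ φ (n + a)` of an element of `ℓ²(ℤᵈ)`. -/
def shift (a : Fin d → ℤ) (φ : L2 d) : L2 d :=
  ⟨fun n => φ (n + a), memℓp_shift (lp.memℓp φ) a⟩

@[simp]
theorem shift_apply (a : Fin d → ℤ) (φ : L2 d) (n : Fin d → ℤ) : shift a φ n = φ (n + a) := rfl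

theorem inner_shift_left (a : Fin d → ℤ) (φ ψ : L2 d) :
    inner ℂ (shift a φ) ψ = inner ℂ φ (shift (-a) ψ) := by
  rw [lp.inner_eq_tsum, lp.inner_eq_tsum,
    ← (Equiv.addRight a).tsum_eq fun n => inner ℂ (φ n) (shift (-a) ψ n)]
  simp

theorem shift_shift (a b : Fin d → ℤ) (φ : L2 d) : shift a (shift b φ) = shift (a + b) φ := by
  ext n
  simp [add_assoc]

theorem shift_zero (φ : L2 d) : shift 0 φ = φ := by
  ext n
  simp

theorem norm_shift (a : Fin d → ℤ) (φ : L2 d) : ‖shift a φ‖ = ‖φ‖ := by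
  have h : inner ℂ (shift a φ) (shift a φ) = inner ℂ φ φ := by
    rw [inner_shift_left, shift_shift, neg_add_cancel, shift_zero]
  rw [inner_self_eq_norm_sq_to_K, inner_self_eq_norm_sq_to_K] at h
  norm_cast at h
  exact (sq_eq_sq₀ (norm_nonneg _) (norm_nonneg _)).1 h

/-- The bounded self-adjoint operator `-Δ` on `ℓ²(ℤᵈ)`. -/
def lapL2 (φ : L2 d) : L2 d :=
  ∑ j, ((φ - shift (basisVec j) φ) + (φ - shift (-basisVec j) φ))

theorem lapL2_apply (φ : L2 d) (n : Fin d → ℤ) : lapL2 φ n = negLaplacian φ n := by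
  rw [lapL2, lp.coeFn_sum, Finset.sum_apply]
  simp [negLaplacian, sub_eq_add_neg]

theorem inner_lapL2_left (φ ψ : L2 d) : inner ℂ (lapL2 φ) ψ = inner ℂ φ (lapL2 ψ) := by
  simp only [lapL2, sum_inner, inner_sum]
  refine Finset.sum_congr rfl fun j _ => ?_
  simp only [inner_add_left, inner_sub_left, inner_add_right, inner_sub_right, inner_shift_left,
    neg_neg]
  ring

theorem re_inner_lapL2_nonneg (φ : L2 d) : 0 ≤ (inner ℂ φ (lapL2 φ)).re := by
  simp only [lapL2, inner_sum, Complex.re_sum]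
  refine Finset.sum_nonneg fun j _ => ?_
  have hs : ∀ a : Fin d → ℤ, (inner ℂ φ (shift a φ)).re ≤ ‖φ‖ ^ 2 := fun a => by
    refine ((Complex.re_le_norm _).trans (norm_inner_le_norm _ _)).trans ?_
    rw [norm_shift, sq]
  have h0 : (inner ℂ φ φ).re = ‖φ‖ ^ 2 := by
    rw [inner_self_eq_norm_sq_to_K]; norm_cast
  simp only [inner_add_right, inner_sub_right, Complex.add_re, Complex.sub_re, h0]
  linarith [hs (basisVec j), hs (-basisVec j)]

/-- The product `V φ` as an element of `ℓ²(ℤᵈ)`. -/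
def mulPot (V : (Fin d → ℤ) → ℝ) (φ : potentialDomain V) : L2 d :=
  ⟨fun n => (V n : ℂ) * (φ : L2 d) n, φ.2⟩

theorem schrodinger_eq (V : (Fin d → ℤ) → ℝ) (φ : (schrodinger V).domain) :
    schrodinger V φ = lapL2 (φ : L2 d) + mulPot V φ := by
  ext n
  rw [lp.coeFn_add, Pi.add_apply, lapL2_apply]
  rfl

theorem schrodinger_apply (V : (Fin d → ℤ) → ℝ) (φ : (schrodinger V).domain) (n : Fin d → ℤ) :
    schrodinger V φ n = negLaplacian (φ : L2 d) n + (V n : ℂ) * (φ : L2 d) n := rfl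

theorem mem_domain_schrodinger {V : (Fin d → ℤ) → ℝ} {φ : L2 d} :
    φ ∈ (schrodinger V).domain ↔ Memℓp (fun n => (V n : ℂ) * φ n) 2 := Iff.rfl

theorem schrodinger_isFormalAdjoint (V : (Fin d → ℤ) → ℝ) :
    (schrodinger V).IsFormalAdjoint (schrodinger V) := by
  intro φ ψ
  rw [schrodinger_eq, schrodinger_eq, inner_add_left, inner_add_right, inner_lapL2_left]
  congr 1
  rw [lp.inner_eq_tsum, lp.inner_eq_tsum]
  refine tsum_congr fun n => ?_
  simp only [mulPot, RCLike.inner_apply, map_mul, Complex.conj_ofReal]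
  ring

theorem formBound_of_le {V : (Fin d → ℤ) → ℝ} {M : ℝ} (hV : ∀ n, M ≤ V n) :
    FormBound (schrodinger V) M := by
  intro φ
  rw [schrodinger_eq, inner_add_right, Complex.add_re]
  have h1 := re_inner_lapL2_nonneg (φ : L2 d)
  have h2 : M * ‖(φ : L2 d)‖ ^ 2 ≤ (inner ℂ (φ : L2 d) (mulPot V φ)).re := by
    have hM : ((M * ‖(φ : L2 d)‖ ^ 2 : ℝ)) = (inner ℂ (φ : L2 d) ((M : ℂ) • (φ : L2 d))).re := by
      rw [inner_smul_right, inner_self_eq_norm_sq_to_K, Complex.re_ofReal_mul]; norm_cast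
    rw [hM]
    refine hasSum_le (fun n => ?_) (Complex.hasSum_re (lp.hasSum_inner _ _))
      (Complex.hasSum_re (lp.hasSum_inner _ _))
    simp only [mulPot, lp.coeFn_smul, Pi.smul_apply, smul_eq_mul, RCLike.inner_apply,
      mul_assoc, Complex.re_ofReal_mul, Complex.mul_conj, Complex.ofReal_re]
    exact mul_le_mul_of_nonneg_right (hV n) (Complex.normSq_nonneg _)
  linarith

end Operator

/-! ### The bottom of the spectrum of a Schrödinger operator -/

section Spectrum

variable {d : ℕ}

/-- The domain of `H_V` is maximal: it contains every `φ ∈ ℓ²` for which `-Δφ + Vφ`, computed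
pointwise, lies in `ℓ²`. -/
theorem exists_mem_domain_of_apply_eq {V : (Fin d → ℤ) → ℝ} {φ η : L2 d}
    (h : ∀ n, negLaplacian φ n + (V n : ℂ) * φ n = η n) :
    ∃ hφ : φ ∈ (schrodinger V).domain, schrodinger V ⟨φ, hφ⟩ = η := by
  have hmem : Memℓp (fun n => (V n : ℂ) * φ n) 2 := by
    have h1 : (fun n => (V n : ℂ) * φ n) = fun n => (η - lapL2 φ) n := by
      funext n
      rw [lp.coeFn_sub, Pi.sub_apply, lapL2_apply, ← h n]
      ring
    rw [h1]
    exact lp.memℓp _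
  refine ⟨hmem, ?_⟩
  ext n
  exact h n

theorem single_mem_domain (V : (Fin d → ℤ) → ℝ) (n : Fin d → ℤ) :
    (lp.single 2 n (1 : ℂ) : L2 d) ∈ (schrodinger V).domain := by
  have h1 : (fun m => (V m : ℂ) * (lp.single 2 n (1 : ℂ) : L2 d) m) =
      fun m => (lp.single 2 n (V n : ℂ) : L2 d) m := by
    funext m
    rcases eq_or_ne m n with rfl | hm
    · simp
    · simp [Pi.single_eq_of_ne hm]
  rw [mem_domain_schrodinger, h1]
  exact lp.memℓp _

theorem inner_single_one (n : Fin d → ℤ) (φ : L2 d) :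
    inner ℂ (lp.single 2 n (1 : ℂ) : L2 d) φ = φ n := by
  rw [lp.inner_single_left]
  simp

theorem inner_schrodinger_single (V : (Fin d → ℤ) → ℝ) (n : Fin d → ℤ) (ψ : L2 d) :
    inner ℂ (schrodinger V ⟨lp.single 2 n (1 : ℂ), single_mem_domain V n⟩) ψ =
      negLaplacian ψ n + (V n : ℂ) * ψ n := by
  have h3 : mulPot V ⟨lp.single 2 n (1 : ℂ), single_mem_domain V n⟩ =
      (V n : ℂ) • (lp.single 2 n (1 : ℂ) : L2 d) := by
    ext m
    change (V m : ℂ) * (lp.single 2 n (1 : ℂ) : L2 d) m = (V n : ℂ) * _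
    rcases eq_or_ne m n with rfl | hm
    · rfl
    · rw [lp.single_apply_ne _ _ _ hm, mul_zero, mul_zero]
  rw [schrodinger_eq, inner_add_left, inner_lapL2_left, inner_single_one, lapL2_apply]
  refine congrArg (negLaplacian ψ n + ·) ((congrArg (fun x => inner ℂ x ψ) h3).trans ?_)
  rw [inner_smul_left, inner_single_one, Complex.conj_ofReal]

theorem FormBound.mul_norm_le {V : (Fin d → ℤ) → ℝ} {a x : ℝ} (h : FormBound (schrodinger V) a)
    (φ : (schrodinger V).domain) :
    (a - x) * ‖(φ : L2 d)‖ ≤ ‖schrodinger V φ - (x : ℂ) • (φ : L2 d)‖ := by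
  have h1 := h φ
  have h2 : (inner ℂ (φ : L2 d) (schrodinger V φ - (x : ℂ) • (φ : L2 d))).re =
      (inner ℂ (φ : L2 d) (schrodinger V φ)).re - x * ‖(φ : L2 d)‖ ^ 2 := by
    rw [inner_sub_right, inner_smul_right, inner_self_eq_norm_sq_to_K, Complex.sub_re,
      Complex.re_ofReal_mul]
    norm_cast
  have h3 := (Complex.re_le_norm _).trans
    (norm_inner_le_norm (𝕜 := ℂ) (φ : L2 d) (schrodinger V φ - (x : ℂ) • (φ : L2 d)))
  rw [h2] at h3
  rcases (norm_nonneg (φ : L2 d)).eq_or_lt with h0 | h0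
  · rw [← h0, mul_zero]
    exact norm_nonneg _
  · refine le_of_mul_le_mul_left ?_ h0
    nlinarith

/-- Real numbers below a lower bound of the form are regular values: `H_V - x` is bounded below,
has closed range since the domain is maximal, and has dense range since a vector orthogonal to the
range solves `H_V ψ = x ψ`. -/
theorem FormBound.notMem_opSpectrum {V : (Fin d → ℤ) → ℝ} {a x : ℝ}
    (h : FormBound (schrodinger V) a) (hx : x < a) : (x : ℂ) ∉ opSpectrum (schrodinger V) := by
  have hax : 0 < a - x := sub_pos.2 hx
  set S : (schrodinger V).domain →ₗ[ℂ] L2 d :=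
    (schrodinger V).toFun - (x : ℂ) • (schrodinger V).domain.subtype with hS
  have hSa : ∀ φ, S φ = schrodinger V φ - (x : ℂ) • (φ : L2 d) := fun φ => rfl
  have hb : ∀ φ : (schrodinger V).domain, (a - x) * ‖(φ : L2 d)‖ ≤ ‖S φ‖ := fun φ => h.mul_norm_le φ
  have hinj : Function.Injective S := by
    rw [← LinearMap.ker_eq_bot, LinearMap.ker_eq_bot']
    intro φ hφ
    have h1 := hb φ
    rw [hφ, norm_zero] at h1
    have h2 : ‖(φ : L2 d)‖ ≤ 0 := by
      by_contra! h3
      linarith [mul_pos hax h3]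
    exact Subtype.ext (norm_le_zero_iff.1 h2)
  have hclosed : IsClosed (LinearMap.range S : Set (L2 d)) := by
    refine IsSeqClosed.isClosed fun u η hu hη => ?_
    choose φ hφ using hu
    have hcau : CauchySeq fun k => (φ k : L2 d) := by
      rw [Metric.cauchySeq_iff]
      intro ε hε
      obtain ⟨N, hN⟩ := Metric.cauchySeq_iff.1 hη.cauchySeq ((a - x) * ε) (mul_pos hax hε)
      refine ⟨N, fun m hm n hn => ?_⟩
      have h1 := hb (φ m - φ n)
      rw [map_sub, hφ, hφ, ← dist_eq_norm, Submodule.coe_sub, ← dist_eq_norm] at h1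
      exact lt_of_mul_lt_mul_left (h1.trans_lt (hN m hm n hn)) hax.le
    obtain ⟨ψ, hψ⟩ := cauchySeq_tendsto_of_complete hcau
    have hpt : ∀ (f : ℕ → L2 d) (χ : L2 d), Tendsto f atTop (𝓝 χ) →
        ∀ n, Tendsto (β := ℂ) (fun k => f k n) atTop (𝓝 (χ n)) := by
      intro f χ hf n
      simp only [← inner_single_one n]
      exact tendsto_const_nhds.inner hf
    obtain ⟨hmem, heq⟩ := exists_mem_domain_of_apply_eq (V := V) (φ := ψ)
      (η := η + (x : ℂ) • ψ) fun n => by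
        have h1 : Tendsto (fun k => negLaplacian (φ k : L2 d) n + (V n : ℂ) * (φ k : L2 d) n)
            atTop (𝓝 (negLaplacian ψ n + (V n : ℂ) * ψ n)) := by
          unfold negLaplacian
          refine (tendsto_finsetSum _ fun j _ => ?_).add ((hpt _ _ hψ n).const_mul _)
          exact ((hpt _ _ hψ _).sub (hpt _ _ hψ _)).add ((hpt _ _ hψ _).sub (hpt _ _ hψ _))
        have h2 : Tendsto (fun k => u k n + (x : ℂ) * (φ k : L2 d) n) atTop
            (𝓝 (η n + (x : ℂ) * ψ n)) := (hpt _ _ hη n).add ((hpt _ _ hψ n).const_mul _)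
        refine tendsto_nhds_unique (h1.congr fun k => ?_) h2
        rw [← hφ k, hSa, lp.coeFn_sub, Pi.sub_apply, schrodinger_apply, lp.coeFn_smul,
          Pi.smul_apply, smul_eq_mul, sub_add_cancel]
    exact ⟨⟨ψ, hmem⟩, by rw [hSa, heq, add_sub_cancel_right]⟩
  have hperp : (LinearMap.range S)ᗮ = ⊥ := by
    rw [Submodule.eq_bot_iff]
    intro ψ hψ
    rw [Submodule.mem_orthogonal] at hψ
    obtain ⟨hmem, heq⟩ := exists_mem_domain_of_apply_eq (V := V) (φ := ψ)
      (η := (x : ℂ) • ψ) fun n => by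
        have h1 := hψ _ ⟨⟨lp.single 2 n (1 : ℂ), single_mem_domain V n⟩, rfl⟩
        rw [hSa, inner_sub_left, inner_schrodinger_single, inner_smul_left, inner_single_one,
          Complex.conj_ofReal] at h1
        exact sub_eq_zero.1 h1
    have h0 : S ⟨ψ, hmem⟩ = S 0 := by rw [hSa, heq, sub_self, map_zero]
    exact congrArg Subtype.val (hinj h0)
  have hsurj : Function.Surjective S := by
    rw [← LinearMap.range_eq_top, ← hclosed.submodule_topologicalClosure_eq]
    exact Submodule.topologicalClosure_eq_top_iff.2 hperp
  let e := LinearEquiv.ofBijective S ⟨hinj, hsurj⟩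
  have he : ∀ η, S (e.symm η) = η := fun η => e.apply_symm_apply η
  rw [opSpectrum, Set.mem_compl_iff, not_not]
  refine ⟨LinearMap.mkContinuous ((schrodinger V).domain.subtype ∘ₗ e.symm.toLinearMap)
    (1 / (a - x)) fun η => ?_, fun η => ⟨(e.symm η).2, he η⟩, fun φ => ?_⟩
  · have h1 := hb (e.symm η)
    rw [he] at h1
    rw [one_div, ← div_eq_inv_mul, le_div_iff₀' hax]
    exact h1
  · exact congrArg Subtype.val (e.symm_apply_apply φ)

/-- For a form that is bounded from below, the bottom of the spectrum is the greatest lower bound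
of the form. -/
theorem hasInf_opSpectrum_iff {V : (Fin d → ℤ) → ℝ} (h : ∃ b, FormBound (schrodinger V) b)
    (a : ℝ) : HasInf (opSpectrum (schrodinger V)) a ↔
      IsGreatest {b | FormBound (schrodinger V) b} a := by
  set S := {b | FormBound (schrodinger V) b} with hS
  have hbdd : BddAbove S := by
    refine ⟨(inner ℂ (lp.single 2 0 (1 : ℂ) : L2 d)
      (schrodinger V ⟨lp.single 2 0 1, single_mem_domain V 0⟩)).re, fun b hb => ?_⟩
    have h1 := hb ⟨lp.single 2 0 1, single_mem_domain V 0⟩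
    simpa [lp.norm_single] using h1
  have hmem : sSup S ∈ S := by
    intro φ
    rcases (norm_nonneg (φ : L2 d)).eq_or_lt with h0 | h0
    · have h2 : (φ : L2 d) = 0 := norm_eq_zero.1 h0.symm
      simp [h2]
    · rw [← le_div_iff₀ (by positivity)]
      refine csSup_le h fun b hb => ?_
      rw [le_div_iff₀ (by positivity)]
      exact hb φ
  have hgr : IsGreatest S (sSup S) := ⟨hmem, fun b hb => le_csSup hbdd hb⟩
  have hglb : HasInf (opSpectrum (schrodinger V)) (sSup S) := by
    refine IsLeast.isGLB ⟨?_, fun x hx => ?_⟩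
    · by_contra hn
      obtain ⟨b, hb, hfb⟩ :=
        FormBound.exists_gt_of_notMem_opSpectrum (schrodinger_isFormalAdjoint V) hmem hn
      exact absurd (hgr.2 hfb) (not_le.2 hb)
    · by_contra! hlt
      exact FormBound.notMem_opSpectrum hmem hlt hx
  constructor
  · intro ha
    rwa [IsGLB.unique ha hglb]
  · intro ha
    rwa [IsGreatest.unique ha hgr]

end Spectrum

/-! ### Finite rank perturbations of critical operators -/

section Critical

variable {d : ℕ}

/-- Multiplication by a multiple of the indicator function of a finite set is a compact operator. The
operator itself is part of the conclusion, since its form is needed as well. -/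
theorem isCompactPotential_indicator (K : Finset (Fin d → ℤ)) (t : ℝ) :
    ∃ T : L2 d →L[ℂ] L2 d, (∀ ψ n, T ψ n = ((if n ∈ K then t else 0 : ℝ) : ℂ) * ψ n) ∧
      IsCompactOperator T := by
  induction K using Finset.induction_on with
  | empty => exact ⟨0, by simp, isCompactOperator_zero⟩
  | insert m K hm ih =>
    obtain ⟨T, hT, hTc⟩ := ih
    refine ⟨T + (innerSL ℂ (lp.single 2 m (1 : ℂ) : L2 d)).smulRight
      (lp.single 2 m (t : ℂ) : L2 d), fun ψ n => ?_, ?_⟩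
    · rw [add_apply, lp.coeFn_add, Pi.add_apply, hT,
        ContinuousLinearMap.smulRight_apply, innerSL_apply_apply, inner_single_one,
        lp.coeFn_smul, Pi.smul_apply, smul_eq_mul]
      rcases eq_or_ne n m with rfl | hn
      · simp [hm, mul_comm]
      · simp [hn]
    · exact hTc.add ((isCompactOperator_of_locallyCompactSpace_rng
        (ContinuousLinearMap.toSpanSingleton ℂ (lp.single 2 m (t : ℂ) : L2 d))).comp_clm
          (innerSL ℂ (lp.single 2 m (1 : ℂ) : L2 d)))

/-- At a critical operator the form is not bounded from below by any positive multiple of the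
indicator function of a nonempty finite set. -/
theorem IsCriticalAt.exists_form_lt {V : (Fin d → ℤ) → ℝ} (hcrit : IsCriticalAt V 0)
    {M : ℝ} (hM : ∀ n, M ≤ V n) {K : Finset (Fin d → ℤ)} (hK : K.Nonempty) {t : ℝ} (ht : 0 < t) :
    ∃ φ : (schrodinger V).domain,
      (inner ℂ (φ : L2 d) (schrodinger V φ)).re < t * ∑ n ∈ K, ‖(φ : L2 d) n‖ ^ 2 := by
  by_contra! hcon
  obtain ⟨T, hT, hTc⟩ := isCompactPotential_indicator K t
  set W : (Fin d → ℤ) → ℝ := fun n => if n ∈ K then t else 0 with hW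
  have hW0 : ∀ n, 0 ≤ W n := fun n => by
    simp only [hW]; split_ifs <;> linarith
  have hWt : ∀ n, W n ≤ t := fun n => by
    simp only [hW]; split_ifs <;> linarith
  have hTform : ∀ φ : L2 d, (inner ℂ φ (T φ)).re = t * ∑ n ∈ K, ‖φ n‖ ^ 2 := by
    intro φ
    rw [lp.inner_eq_tsum, tsum_eq_sum (s := K), Complex.re_sum, Finset.mul_sum]
    · refine Finset.sum_congr rfl fun n hn => ?_
      rw [hT, if_pos hn, RCLike.inner_apply, mul_assoc, Complex.re_ofReal_mul, Complex.mul_conj,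
        Complex.normSq_eq_norm_sq, Complex.ofReal_re]
    · intro n hn
      rw [hT, if_neg hn]
      simp
  have hdom1 : ∀ φ : (schrodinger V).domain,
      ∃ h : (φ : L2 d) ∈ (schrodinger fun n => V n - W n).domain,
        schrodinger (fun n => V n - W n) ⟨φ, h⟩ = schrodinger V φ - T φ := fun φ =>
    exists_mem_domain_of_apply_eq fun n => by
      rw [lp.coeFn_sub, Pi.sub_apply, schrodinger_apply, hT]
      push_cast
      ring
  have hdom2 : ∀ φ : (schrodinger fun n => V n - W n).domain,
      ∃ h : (φ : L2 d) ∈ (schrodinger V).domain,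
        schrodinger V ⟨φ, h⟩ = schrodinger (fun n => V n - W n) φ + T φ := fun φ =>
    exists_mem_domain_of_apply_eq fun n => by
      rw [lp.coeFn_add, Pi.add_apply, schrodinger_apply, hT]
      push_cast
      ring
  have hgr := (hasInf_opSpectrum_iff ⟨M, formBound_of_le hM⟩ 0).1 hcrit.1
  have hzero : FormBound (schrodinger fun n => V n - W n) 0 := by
    intro φ
    obtain ⟨h, heq⟩ := hdom2 φ
    have h1 := hcon ⟨φ, h⟩
    rw [heq, inner_add_right, Complex.add_re, hTform] at h1
    linarith
  have hgr' : IsGreatest {b | FormBound (schrodinger fun n => V n - W n) b} 0 := by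
    refine ⟨hzero, fun b hb => hgr.2 fun φ => ?_⟩
    obtain ⟨h, heq⟩ := hdom1 φ
    have h1 := hb ⟨φ, h⟩
    rw [heq, inner_sub_right, Complex.sub_re, hTform] at h1
    have h2 : 0 ≤ t * ∑ n ∈ K, ‖(φ : L2 d) n‖ ^ 2 :=
      mul_nonneg ht.le (Finset.sum_nonneg fun n _ => sq_nonneg _)
    exact h1.trans (by linarith)
  have hfin := hcrit.2 W hW0 ⟨T, hT, hTc⟩ ((hasInf_opSpectrum_iff ⟨0, hzero⟩ 0).2 hgr')
  obtain ⟨m, hm⟩ := hK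
  have h3 := hfin m
  simp only [hW, if_pos hm] at h3
  exact ht.ne' h3

/-! ### Null sequences and supersolutions -/

/-- The pointwise action of `-Δ + V` on real functions on the lattice. -/
def realSchrodinger (V f : (Fin d → ℤ) → ℝ) (n : Fin d → ℤ) : ℝ :=
  ∑ j, ((f n - f (n + basisVec j)) + (f n - f (n - basisVec j))) + V n * f n

theorem schrodinger_apply_ofReal {V f : (Fin d → ℤ) → ℝ} {φ : (schrodinger V).domain}
    (hf : ∀ n, (φ : L2 d) n = f n) (n : Fin d → ℤ) :
    schrodinger V φ n = (realSchrodinger V f n : ℂ) := by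
  rw [schrodinger_apply, negLaplacian, realSchrodinger]
  simp only [hf]
  push_cast
  rfl

theorem memℓp_of_norm_le {f g : (Fin d → ℤ) → ℂ} (hg : Memℓp g 2) (h : ∀ n, ‖f n‖ ≤ ‖g n‖) :
    Memℓp f 2 := by
  have h2 : 0 < (2 : ℝ≥0∞).toReal := by norm_num
  rw [memℓp_gen_iff h2] at hg ⊢
  exact hg.of_nonneg_of_le (fun n => by positivity)
    fun n => Real.rpow_le_rpow (norm_nonneg _) (h n) h2.le

theorem exists_mem_domain_of_abs_le {V f : (Fin d → ℤ) → ℝ} (φ : (schrodinger V).domain)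
    (h : ∀ n, |f n| ≤ ‖(φ : L2 d) n‖) :
    ∃ ψ : (schrodinger V).domain, ∀ n, (ψ : L2 d) n = f n := by
  have h1 : Memℓp (fun n => (f n : ℂ)) 2 :=
    memℓp_of_norm_le (lp.memℓp (φ : L2 d)) fun n => by simpa using h n
  refine ⟨⟨⟨_, h1⟩, memℓp_of_norm_le φ.2 fun n => ?_⟩, fun n => rfl⟩
  rw [norm_mul, norm_mul]
  exact mul_le_mul_of_nonneg_left (by simpa using h n) (norm_nonneg _)

/-- Passing to the modulus does not increase the form. -/
theorem form_norm_le {V : (Fin d → ℤ) → ℝ} {φ ψ : (schrodinger V).domain}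
    (h : ∀ n, (ψ : L2 d) n = (‖(φ : L2 d) n‖ : ℝ)) :
    (inner ℂ (ψ : L2 d) (schrodinger V ψ)).re ≤ (inner ℂ (φ : L2 d) (schrodinger V φ)).re := by
  refine hasSum_le (fun n => ?_) (Complex.hasSum_re (lp.hasSum_inner _ _))
      (Complex.hasSum_re (lp.hasSum_inner _ _))
  set f : (Fin d → ℤ) → ℂ := fun n => (φ : L2 d) n with hf
  have key : ∀ m, (f m * (starRingEnd ℂ) (f n)).re ≤ ‖f m‖ * ‖f n‖ := fun m => by
    refine (Complex.re_le_norm _).trans ?_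
    rw [norm_mul, RCLike.norm_conj]
  have hself : (f n * (starRingEnd ℂ) (f n)).re = ‖f n‖ * ‖f n‖ := by
    rw [Complex.mul_conj, Complex.normSq_eq_norm_sq, Complex.ofReal_re, sq]
  rw [schrodinger_apply_ofReal h, h, schrodinger_apply, RCLike.inner_apply, RCLike.inner_apply,
    Complex.conj_ofReal, ← Complex.ofReal_mul, Complex.ofReal_re, realSchrodinger, negLaplacian]
  simp only [add_mul, Finset.sum_mul, sub_mul, Complex.add_re, Complex.re_sum, Complex.sub_re,
    mul_assoc, Complex.re_ofReal_mul]
  change _ ≤ ∑ j, ((f n * (starRingEnd ℂ) (f n)).re -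
    (f (n + basisVec j) * (starRingEnd ℂ) (f n)).re + ((f n * (starRingEnd ℂ) (f n)).re -
    (f (n - basisVec j) * (starRingEnd ℂ) (f n)).re)) + V n * (f n * (starRingEnd ℂ) (f n)).re
  rw [hself]
  gcongr
  · exact key _
  · exact key _

/-- Truncation at a supersolution does not increase the form. If `f ≥ 0` lies below `v` on `K` and
`v` is a supersolution off `K`, then `w = f - min f v` is supported where `min f v = v`, so that
`⟪w, H (min f v)⟫ ≥ ⟪w, H v⟫ ≥ 0`. -/
theorem form_min_le {V v f : (Fin d → ℤ) → ℝ} (h0 : FormBound (schrodinger V) 0)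
    {K : Finset (Fin d → ℤ)} (hsup : ∀ n ∉ K, 0 ≤ realSchrodinger V v n)
    (hfK : ∀ n ∈ K, f n ≤ v n) {φ ψ : (schrodinger V).domain}
    (hφ : ∀ n, (φ : L2 d) n = f n) (hψ : ∀ n, (ψ : L2 d) n = (min (f n) (v n) : ℝ)) :
    (inner ℂ (ψ : L2 d) (schrodinger V ψ)).re ≤ (inner ℂ (φ : L2 d) (schrodinger V φ)).re := by
  have hw : ∀ n, ((φ - ψ : (schrodinger V).domain) : L2 d) n =
      ((f n - min (f n) (v n) : ℝ) : ℂ) := fun n => by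
    rw [Submodule.coe_sub, lp.coeFn_sub, Pi.sub_apply, hφ, hψ, Complex.ofReal_sub]
  have h1 := form_add_smul (schrodinger_isFormalAdjoint V) ψ (φ - ψ) 1
  rw [Complex.ofReal_one, one_smul, add_sub_cancel] at h1
  have h2 := h0 (φ - ψ)
  have h3 : 0 ≤ (inner ℂ ((φ - ψ : (schrodinger V).domain) : L2 d) (schrodinger V ψ)).re := by
    refine (Complex.hasSum_re (lp.hasSum_inner _ _)).nonneg fun n => ?_
    rw [hw, schrodinger_apply_ofReal hψ, RCLike.inner_apply, Complex.conj_ofReal,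
      ← Complex.ofReal_mul, Complex.ofReal_re]
    rcases le_total (f n) (v n) with hle | hle
    · rw [min_eq_left hle, sub_self, mul_zero]
    · by_cases hn : n ∈ K
      · rw [min_eq_left (hfK n hn), sub_self, mul_zero]
      · refine mul_nonneg ((hsup n hn).trans ?_) (sub_nonneg.2 (min_le_left _ _))
        unfold realSchrodinger
        simp only [min_eq_right hle]
        gcongr
        · exact min_le_right _ _
        · exact min_le_right _ _
  rw [h1]
  linarith

/-- Below a supersolution `v` that is at least one on `K` there are nonnegative functions that are
normalized on `K` and for which `(-Δ + V) g` is as small as desired. -/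
theorem IsCriticalAt.exists_approx {V : (Fin d → ℤ) → ℝ} (hcrit : IsCriticalAt V 0)
    {M : ℝ} (hM : ∀ n, M ≤ V n) {K : Finset (Fin d → ℤ)} (hK : K.Nonempty)
    {v : (Fin d → ℤ) → ℝ} (hv0 : ∀ n, 0 ≤ v n) (hvK : ∀ n ∈ K, 1 ≤ v n)
    (hsup : ∀ n ∉ K, 0 ≤ realSchrodinger V v n) {t : ℝ} (ht : 0 < t) :
    ∃ g : (Fin d → ℤ) → ℝ, (∀ n, g n ∈ Set.Icc 0 (v n)) ∧ ∑ n ∈ K, g n ^ 2 = 1 ∧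
      ∀ n, realSchrodinger V g n ^ 2 ≤
        t * (inner ℂ (lp.single 2 n (1 : ℂ) : L2 d)
          (schrodinger V ⟨lp.single 2 n 1, single_mem_domain V n⟩)).re := by
  have h0 : FormBound (schrodinger V) 0 :=
    ((hasInf_opSpectrum_iff ⟨M, formBound_of_le hM⟩ 0).1 hcrit.1).1
  obtain ⟨φ, hφ⟩ := hcrit.exists_form_lt hM hK ht
  set S := ∑ n ∈ K, ‖(φ : L2 d) n‖ ^ 2 with hS
  have hφ0 := h0 φ
  rw [zero_mul] at hφ0
  have hSpos : 0 < S := pos_of_mul_pos_right (hφ0.trans_lt hφ) ht.le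
  set c : ℝ := (√S)⁻¹ with hc
  have hc2 : c ^ 2 * S = 1 := by
    rw [hc, inv_pow, Real.sq_sqrt hSpos.le, inv_mul_cancel₀ hSpos.ne']
  set φ₁ : (schrodinger V).domain := (c : ℂ) • φ with hφ₁
  have hφ₁n : ∀ n, ‖(φ₁ : L2 d) n‖ = c * ‖(φ : L2 d) n‖ := fun n => by
    rw [hφ₁, Submodule.coe_smul, lp.coeFn_smul, Pi.smul_apply, norm_smul, Complex.norm_real,
      Real.norm_of_nonneg (by positivity)]
  have hform₁ : (inner ℂ (φ₁ : L2 d) (schrodinger V φ₁)).re ≤ t := by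
    rw [hφ₁, LinearPMap.map_smul, Submodule.coe_smul, inner_smul_left, inner_smul_right,
      Complex.conj_ofReal, Complex.re_ofReal_mul, Complex.re_ofReal_mul]
    nlinarith [mul_le_mul_of_nonneg_left hφ.le (sq_nonneg c)]
  obtain ⟨φ₂, hφ₂⟩ := exists_mem_domain_of_abs_le (f := fun n => ‖(φ₁ : L2 d) n‖) φ₁
    fun n => by simp
  have hform₂ := (form_norm_le hφ₂).trans hform₁
  have hsum₁ : ∑ n ∈ K, ‖(φ₁ : L2 d) n‖ ^ 2 = 1 := by
    simp only [hφ₁n, mul_pow, ← Finset.mul_sum]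
    exact hc2
  have hfK : ∀ n ∈ K, ‖(φ₁ : L2 d) n‖ ≤ v n := fun n hn => by
    refine le_trans ?_ (hvK n hn)
    have h1 : ‖(φ₁ : L2 d) n‖ ^ 2 ≤ 1 := by
      rw [← hsum₁]
      exact Finset.single_le_sum (f := fun n => ‖(φ₁ : L2 d) n‖ ^ 2)
        (fun m _ => sq_nonneg _) hn
    nlinarith [norm_nonneg ((φ₁ : L2 d) n)]
  obtain ⟨ψ, hψ⟩ := exists_mem_domain_of_abs_le
    (f := fun n => min ‖(φ₁ : L2 d) n‖ (v n)) φ₁ fun n => by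
      rw [abs_of_nonneg (le_min (norm_nonneg _) (hv0 n))]
      exact min_le_left _ _
  have hform := (form_min_le h0 hsup hfK hφ₂ hψ).trans hform₂
  refine ⟨fun n => min ‖(φ₁ : L2 d) n‖ (v n),
    fun n => ⟨le_min (norm_nonneg _) (hv0 n), min_le_right _ _⟩, ?_, fun n => ?_⟩
  · rw [← hsum₁]
    exact Finset.sum_congr rfl fun n hn => by simp only [min_eq_left (hfK n hn)]
  · have hcs := h0.cauchySchwarz (schrodinger_isFormalAdjoint V) ψ
      ⟨lp.single 2 n 1, single_mem_domain V n⟩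
    simp only [Complex.ofReal_zero, zero_smul, sub_zero] at hcs
    have hδ := h0 ⟨lp.single 2 n 1, single_mem_domain V n⟩
    rw [zero_mul] at hδ
    rw [inner_single_one, schrodinger_apply_ofReal hψ, Complex.ofReal_re] at hcs
    exact hcs.trans (mul_le_mul_of_nonneg_right hform hδ)

/-- A critical operator with a nonnegative square summable supersolution near infinity has the
eigenvalue `0`: the approximate solutions below the supersolution converge along a subsequence to a
nonzero solution. -/
theorem IsCriticalAt.zero_mem_pointSpectrum {V : (Fin d → ℤ) → ℝ} (hcrit : IsCriticalAt V 0)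
    {M : ℝ} (hM : ∀ n, M ≤ V n) {K : Finset (Fin d → ℤ)} (hK : K.Nonempty)
    {v : (Fin d → ℤ) → ℝ} (hv0 : ∀ n, 0 ≤ v n) (hvK : ∀ n ∈ K, 0 < v n)
    (hsup : ∀ n ∉ K, 0 ≤ realSchrodinger V v n) (hv2 : Summable fun n => v n ^ 2) :
    (0 : ℂ) ∈ pointSpectrum (schrodinger V) := by
  set C : ℝ := ∑ n ∈ K, (v n)⁻¹ with hC
  have hC0 : 0 ≤ C := Finset.sum_nonneg fun n hn => (inv_pos.2 (hvK n hn)).le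
  have hCv0 : ∀ n, 0 ≤ C * v n := fun n => mul_nonneg hC0 (hv0 n)
  have hCvK : ∀ n ∈ K, 1 ≤ C * v n := fun n hn => by
    rw [← inv_mul_cancel₀ (hvK n hn).ne']
    exact mul_le_mul_of_nonneg_right (Finset.single_le_sum (f := fun n => (v n)⁻¹)
      (fun m hm => (inv_pos.2 (hvK m hm)).le) hn) (hv0 n)
  have hCsup : ∀ n ∉ K, 0 ≤ realSchrodinger V (fun n => C * v n) n := fun n hn => by
    have h1 : realSchrodinger V (fun n => C * v n) n = C * realSchrodinger V v n := by
      simp only [realSchrodinger, mul_add, Finset.mul_sum, mul_sub]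
      ring
    rw [h1]
    exact mul_nonneg hC0 (hsup n hn)
  have hex := fun k : ℕ => hcrit.exists_approx hM hK hCv0 hCvK hCsup
    (t := 1 / ((k : ℝ) + 1)) (by positivity)
  choose g hg hgK hgH using hex
  have hcomp : IsCompact (Set.univ.pi fun n => Set.Icc 0 (C * v n)) :=
    isCompact_univ_pi fun n => isCompact_Icc
  obtain ⟨u, hu, σ, hσ, hlim⟩ := hcomp.tendsto_subseq (x := g) fun k n _ => hg k n
  have hlimn : ∀ n, Tendsto (fun k => g (σ k) n) atTop (𝓝 (u n)) := fun n =>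
    (tendsto_pi_nhds.1 hlim) n
  have huK : ∑ n ∈ K, u n ^ 2 = 1 := by
    refine tendsto_nhds_unique (tendsto_finsetSum K fun n _ => (hlimn n).pow 2) ?_
    simp only [hgK]
    exact tendsto_const_nhds
  have huH : ∀ n, realSchrodinger V u n = 0 := fun n => by
    have h1 : Tendsto (fun k => realSchrodinger V (g (σ k)) n) atTop
        (𝓝 (realSchrodinger V u n)) := by
      unfold realSchrodinger
      refine (tendsto_finsetSum _ fun j _ => ?_).add ((hlimn n).const_mul _)
      exact ((hlimn _).sub (hlimn _)).add ((hlimn _).sub (hlimn _))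
    have h2 : Tendsto (fun k => realSchrodinger V (g (σ k)) n ^ 2) atTop (𝓝 0) := by
      refine squeeze_zero (fun k => sq_nonneg _) (fun k => hgH (σ k) n) ?_
      rw [← zero_mul ((inner ℂ (lp.single 2 n (1 : ℂ) : L2 d)
          (schrodinger V ⟨lp.single 2 n 1, single_mem_domain V n⟩)).re)]
      exact (tendsto_one_div_add_atTop_nhds_zero_nat.comp hσ.tendsto_atTop).mul_const _
    exact pow_eq_zero_iff (two_ne_zero) |>.1 (tendsto_nhds_unique (h1.pow 2) h2)
  have humem : Memℓp (fun n => (u n : ℂ)) 2 := by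
    rw [memℓp_gen_iff (by norm_num)]
    refine (hv2.mul_left (C ^ 2)).of_nonneg_of_le (fun n => by positivity) fun n => ?_
    have h1 := hu n (Set.mem_univ n)
    have h2 : ‖(u n : ℂ)‖ = u n := by
      rw [Complex.norm_real, Real.norm_of_nonneg h1.1]
    rw [h2, ENNReal.toReal_ofNat, Real.rpow_ofNat, ← mul_pow]
    exact pow_le_pow_left₀ h1.1 h1.2 2
  obtain ⟨hdom, heq⟩ := exists_mem_domain_of_apply_eq (V := V) (φ := ⟨_, humem⟩) (η := 0)
    fun n => by
      have h1 := congrArg (fun x : ℝ => (x : ℂ)) (huH n)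
      simp only [realSchrodinger] at h1
      push_cast at h1
      exact h1
  refine ⟨⟨_, hdom⟩, fun h => ?_, by rw [heq, zero_smul]⟩
  have h1 : ∀ n, u n = 0 := fun n => by
    have h2 := congrArg (fun φ : L2 d => φ n) h
    exact Complex.ofReal_eq_zero.1 h2
  simp [h1] at huK

end Critical

/-! ### Iterated logarithms -/

section IterLog

@[simp]
theorem iterLog_zero (x : ℝ) : iterLog 0 x = x := rfl

theorem iterLog_succ (k : ℕ) (x : ℝ) : iterLog (k + 1) x = Real.log (iterLog k x) :=
  Function.iterate_succ_apply' _ _ _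

theorem iterLog_log (k : ℕ) (x : ℝ) : iterLog k (Real.log x) = Real.log (iterLog k x) := by
  rw [← iterLog_succ]
  exact (Function.iterate_succ_apply _ _ _).symm

theorem tendsto_iterLog (k : ℕ) : Tendsto (iterLog k) atTop atTop := by
  induction k with
  | zero => exact tendsto_id
  | succ k ih => exact (Real.tendsto_log_atTop.comp ih).congr fun x => (iterLog_succ k x).symm

theorem eventually_one_le_iterLog (s : ℕ) : ∀ᶠ z in atTop, ∀ i ≤ s, 1 ≤ iterLog i z := by
  have h : ∀ᶠ z in atTop, ∀ i ∈ Finset.range (s + 1), 1 ≤ iterLog i z :=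
    (Finset.eventually_all _).2 fun i _ => (tendsto_iterLog i).eventually_ge_atTop 1
  filter_upwards [h] with z hz i hi
  exact hz i (Finset.mem_range_succ_iff.2 hi)

theorem iterLog_le_iterLog {i : ℕ} {x y : ℝ} (hx : ∀ j ≤ i, 1 ≤ iterLog j x) (hxy : x ≤ y) :
    iterLog i x ≤ iterLog i y := by
  induction i with
  | zero => exact hxy
  | succ i ih =>
    rw [iterLog_succ, iterLog_succ]
    exact Real.log_le_log (zero_lt_one.trans_le (hx i i.le_succ))
      (ih fun j hj => hx j (hj.trans i.le_succ))

/-- The derivative `∏_{i < k} 1 / log_i z` of the `k`-fold iterated logarithm. -/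
def iterLogDeriv (k : ℕ) (z : ℝ) : ℝ := ∏ i ∈ Finset.range k, (iterLog i z)⁻¹

theorem iterLogDeriv_succ (k : ℕ) (z : ℝ) :
    iterLogDeriv (k + 1) z = iterLogDeriv k z * (iterLog k z)⁻¹ :=
  Finset.prod_range_succ _ _

theorem hasDerivAt_iterLog {k : ℕ} {z : ℝ} (hz : ∀ j ≤ k, 1 ≤ iterLog j z) :
    HasDerivAt (iterLog k) (iterLogDeriv k z) z := by
  induction k with
  | zero => exact (hasDerivAt_id z).congr_deriv (by simp [iterLogDeriv])
  | succ k ih =>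
    have h1 := (ih fun j hj => hz j (hj.trans k.le_succ)).log
      (zero_lt_one.trans_le (hz k k.le_succ)).ne'
    rw [iterLogDeriv_succ, ← div_eq_mul_inv]
    exact h1.congr_of_eventuallyEq (Eventually.of_forall fun x => iterLog_succ k x)

end IterLog

/-! ### The comparison function -/

section Decay

/-- `∑_{i=1}^s ½ log_i z + ε log_s z`. At `z = log r` its exponential is
`∏_{i=1}^s √(log_i r) · (log_s r)^ε`. -/
def logRate (s : ℕ) (ε z : ℝ) : ℝ :=
  1 / 2 * ∑ i ∈ Finset.Icc 1 s, iterLog i z + ε * iterLog s z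

theorem logRate_le_logRate {s : ℕ} {ε x y : ℝ} (hε : 0 < ε) (hx : ∀ j ≤ s, 1 ≤ iterLog j x)
    (hxy : x ≤ y) : logRate s ε x ≤ logRate s ε y := by
  unfold logRate
  gcongr with i hi
  · exact iterLog_le_iterLog (fun j hj => hx j (hj.trans (Finset.mem_Icc.1 hi).2)) hxy
  · exact iterLog_le_iterLog hx hxy

theorem exp_neg_sum_iterLog {s : ℕ} {z : ℝ} (hz : ∀ j ≤ s, 1 ≤ iterLog j z) :
    Real.exp (-∑ i ∈ Finset.Icc 1 s, iterLog i z) = iterLogDeriv s z := by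
  induction s with
  | zero => simp [iterLogDeriv]
  | succ s ih =>
    rw [Finset.sum_Icc_succ_top (by omega), neg_add, Real.exp_add,
      ih fun j hj => hz j (hj.trans s.le_succ), iterLogDeriv_succ, iterLog_succ, Real.exp_neg,
      Real.exp_log (zero_lt_one.trans_le (hz s s.le_succ))]

/-- Convergence in logarithmic scale: `exp (-2 logRate)` is minus the derivative of
`exp (-2 ε log_s z) / (2 ε)`, so that its sum along an arithmetic progression telescopes. -/
theorem summable_exp_logRate (s : ℕ) {ε c : ℝ} (hε : 0 < ε) (hc : 0 < c) :
    Summable fun k : ℕ => Real.exp (-2 * logRate s ε (c * k)) := by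
  obtain ⟨z₀, hz₀⟩ := eventually_atTop.1 (eventually_one_le_iterLog s)
  obtain ⟨k₀, hk₀⟩ := exists_nat_ge (z₀ / c)
  rw [div_le_iff₀' hc] at hk₀
  have hz : ∀ z, c * k₀ ≤ z → ∀ j ≤ s, 1 ≤ iterLog j z := fun z h => hz₀ z (hk₀.trans h)
  set Φ : ℝ → ℝ := fun z => Real.exp (-2 * ε * iterLog s z) / (2 * ε) with hΦ
  have hderiv : ∀ z, c * k₀ ≤ z → HasDerivAt Φ (-Real.exp (-2 * logRate s ε z)) z := by
    intro z h
    have h1 := (((hasDerivAt_iterLog (hz z h)).const_mul (-2 * ε)).exp).div_const (2 * ε)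
    have h2 : Real.exp (-2 * logRate s ε z) =
        Real.exp (-2 * ε * iterLog s z) * iterLogDeriv s z := by
      rw [← exp_neg_sum_iterLog (hz z h), ← Real.exp_add]
      congr 1
      unfold logRate
      ring
    refine h1.congr_deriv ?_
    rw [h2]
    field_simp
  have hstep : ∀ k : ℕ, Real.exp (-2 * logRate s ε (c * ((k + (k₀ + 1) : ℕ) : ℝ))) ≤
      c⁻¹ * (Φ (c * ((k + k₀ : ℕ) : ℝ)) - Φ (c * ((k + 1 + k₀ : ℕ) : ℝ))) := by
    intro k
    set x : ℝ := c * ((k + k₀ : ℕ) : ℝ) with hx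
    have hy : c * ((k + 1 + k₀ : ℕ) : ℝ) = x + c := by rw [hx]; push_cast; ring
    have hy' : c * ((k + (k₀ + 1) : ℕ) : ℝ) = x + c := by rw [hx]; push_cast; ring
    have hx0 : c * k₀ ≤ x := by
      rw [hx]
      gcongr
      omega
    obtain ⟨ξ, hξ, hslope⟩ := exists_hasDerivAt_eq_slope Φ
      (fun z => -Real.exp (-2 * logRate s ε z)) (lt_add_of_pos_right x hc)
      (fun z hz' => (hderiv z (hx0.trans hz'.1)).continuousAt.continuousWithinAt)
      (fun z hz' => hderiv z (hx0.trans hz'.1.le))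
    rw [hy, hy', inv_mul_eq_div, le_div_iff₀ hc]
    have h1 : Φ x - Φ (x + c) = Real.exp (-2 * logRate s ε ξ) * c := by
      rw [eq_div_iff (by linarith)] at hslope
      linarith
    have h2 := logRate_le_logRate hε (hz ξ (hx0.trans hξ.1.le)) hξ.2.le
    rw [h1]
    exact mul_le_mul_of_nonneg_right (Real.exp_le_exp.2 (by linarith)) hc.le
  rw [← summable_nat_add_iff (k₀ + 1)]
  refine summable_of_sum_range_le (c := c⁻¹ * Φ (c * ((0 + k₀ : ℕ) : ℝ)))
    (fun k => (Real.exp_pos _).le) fun n => ?_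
  refine (Finset.sum_le_sum fun k _ => hstep k).trans ?_
  rw [← Finset.mul_sum, Finset.sum_range_sub' fun k : ℕ => Φ (c * ((k + k₀ : ℕ) : ℝ))]
  have h1 : 0 ≤ Φ (c * ((n + k₀ : ℕ) : ℝ)) := by positivity
  gcongr
  linarith

variable {d : ℕ}

/-- The comparison function `|n|^{-d/2} ∏_{i=1}^s (log_i |n|)^{-1/2} (log_s |n|)^{-ε}`, written as
an exponential in the variable `log |n|`, which makes it positive on the whole lattice. -/
def decay (s : ℕ) (ε : ℝ) (n : Fin d → ℤ) : ℝ :=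
  Real.exp (-((d : ℝ) / 2 * Real.log (latticeNorm n) + logRate s ε (Real.log (latticeNorm n))))

theorem decay_pos (s : ℕ) (ε : ℝ) (n : Fin d → ℤ) : 0 < decay s ε n := Real.exp_pos _

theorem latticeNorm_nonneg (n : Fin d → ℤ) : 0 ≤ latticeNorm n := Real.sqrt_nonneg _

theorem latticeNorm_sq (n : Fin d → ℤ) : latticeNorm n ^ 2 = ∑ j, (n j : ℝ) ^ 2 :=
  Real.sq_sqrt (Finset.sum_nonneg fun _ _ => sq_nonneg _)

theorem abs_coord_le_latticeNorm (n : Fin d → ℤ) (j : Fin d) : |(n j : ℝ)| ≤ latticeNorm n := by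
  refine Real.abs_le_sqrt ?_
  exact Finset.single_le_sum (f := fun j => (n j : ℝ) ^ 2) (fun _ _ => sq_nonneg _)
    (Finset.mem_univ j)

theorem latticeNorm_add_basisVec_sq (n : Fin d → ℤ) (j : Fin d) :
    latticeNorm (n + basisVec j) ^ 2 = latticeNorm n ^ 2 + (2 * n j + 1) := by
  rw [latticeNorm_sq, latticeNorm_sq, ← Finset.add_sum_erase _ _ (Finset.mem_univ j),
    ← Finset.add_sum_erase Finset.univ (fun i => (n i : ℝ) ^ 2) (Finset.mem_univ j)]
  have h : ∑ i ∈ Finset.univ.erase j, (((n + basisVec j) i : ℤ) : ℝ) ^ 2 =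
      ∑ i ∈ Finset.univ.erase j, (n i : ℝ) ^ 2 :=
    Finset.sum_congr rfl fun i hi => by
      simp [basisVec, Pi.single_eq_of_ne (Finset.ne_of_mem_erase hi)]
  rw [h]
  simp [basisVec]
  ring

theorem latticeNorm_sub_basisVec_sq (n : Fin d → ℤ) (j : Fin d) :
    latticeNorm (n - basisVec j) ^ 2 = latticeNorm n ^ 2 + (-2 * n j + 1) := by
  have h := latticeNorm_add_basisVec_sq (n - basisVec j) j
  rw [sub_add_cancel] at h
  have h1 : (((n - basisVec j) j : ℤ) : ℝ) = n j - 1 := by simp [basisVec]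
  rw [h1] at h
  linarith

theorem sub_one_le_latticeNorm_add (n : Fin d → ℤ) (j : Fin d) :
    latticeNorm n - 1 ≤ latticeNorm (n + basisVec j) := by
  have h1 := latticeNorm_add_basisVec_sq n j
  have h2 := neg_le_of_abs_le (abs_coord_le_latticeNorm n j)
  refine (abs_le_of_sq_le_sq' ?_ (latticeNorm_nonneg _)).2
  nlinarith

theorem sub_one_le_latticeNorm_sub (n : Fin d → ℤ) (j : Fin d) :
    latticeNorm n - 1 ≤ latticeNorm (n - basisVec j) := by
  have h1 := latticeNorm_sub_basisVec_sq n j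
  have h2 := le_of_abs_le (abs_coord_le_latticeNorm n j)
  refine (abs_le_of_sq_le_sq' ?_ (latticeNorm_nonneg _)).2
  nlinarith

theorem setOf_latticeNorm_le_subset (R : ℕ) : ({n : Fin d → ℤ | latticeNorm n ≤ R} : Set _) ⊆
    (Fintype.piFinset fun _ : Fin d => Finset.Icc (-(R : ℤ)) R : Finset (Fin d → ℤ)) := by
  intro n hn
  rw [Finset.mem_coe, Fintype.mem_piFinset]
  intro j
  have h := abs_le.1 ((abs_coord_le_latticeNorm n j).trans hn)
  rw [Finset.mem_Icc]
  exact ⟨by exact_mod_cast h.1, by exact_mod_cast h.2⟩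

/-- The dyadic shell of a lattice point: `2 ^ k ≤ |n| < 2 ^ (k + 1)` for `|n| ≥ 1`. -/
def shell (n : Fin d → ℤ) : ℕ := Nat.log 2 ⌊latticeNorm n⌋₊

theorem latticeNorm_le_of_shell (n : Fin d → ℤ) : latticeNorm n ≤ (2 ^ (shell n + 1) : ℕ) := by
  have h1 := Nat.lt_pow_succ_log_self (b := 2) (by norm_num) ⌊latticeNorm n⌋₊
  have h2 := Nat.lt_floor_add_one (latticeNorm n)
  refine h2.le.trans ?_
  exact_mod_cast h1

theorem le_latticeNorm_of_shell {n : Fin d → ℤ} (h : shell n ≠ 0) :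
    (2 : ℝ) ^ shell n ≤ latticeNorm n := by
  have h0 : ⌊latticeNorm n⌋₊ ≠ 0 := fun h0 => h (by rw [shell, h0]; simp)
  have h1 := Nat.pow_log_le_self 2 h0
  have h2 := Nat.floor_le (latticeNorm_nonneg n)
  refine le_trans ?_ h2
  exact_mod_cast h1

theorem card_shell_le (k : ℕ) (F : Finset (Fin d → ℤ)) (hF : ∀ n ∈ F, shell n = k) :
    (F.card : ℝ) ≤ 8 ^ d * ((2 : ℝ) ^ k) ^ d := by
  have h1 : F ⊆ Fintype.piFinset fun _ : Fin d =>
      Finset.Icc (-((2 ^ (k + 1) : ℕ) : ℤ)) ((2 ^ (k + 1) : ℕ) : ℤ) := fun n hn => by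
    have h2 := latticeNorm_le_of_shell n
    rw [hF n hn] at h2
    exact setOf_latticeNorm_le_subset _ h2
  have h3 := Finset.card_le_card h1
  rw [Fintype.card_piFinset_const, Int.card_Icc] at h3
  rw [← mul_pow]
  refine le_trans (Nat.cast_le.2 h3) ?_
  rw [Nat.cast_pow]
  refine pow_le_pow_left₀ (Nat.cast_nonneg _) ?_ d
  have h4 : (((2 ^ (k + 1) : ℕ) : ℤ) + 1 - -((2 ^ (k + 1) : ℕ) : ℤ)).toNat =
      2 ^ (k + 2) + 1 := by
    have h5 : 2 ^ (k + 2) = 2 * 2 ^ (k + 1) := by ring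
    rw [h5]
    generalize 2 ^ (k + 1) = m
    omega
  rw [h4]
  have h5 : (1 : ℝ) ≤ 2 ^ k := one_le_pow₀ (by norm_num)
  push_cast
  rw [pow_add]
  linarith

theorem finite_shell (k : ℕ) : {n : Fin d → ℤ | shell n = k}.Finite :=
  Set.Finite.subset (Finset.finite_toSet (Fintype.piFinset fun _ : Fin d =>
    Finset.Icc (-((2 ^ (k + 1) : ℕ) : ℤ)) ((2 ^ (k + 1) : ℕ) : ℤ))) fun n hn =>
      setOf_latticeNorm_le_subset _ (by
        have h := latticeNorm_le_of_shell n
        rwa [show shell n = k from hn] at h)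

theorem decay_sq_le {s : ℕ} {ε : ℝ} (hε : 0 < ε) {n : Fin d → ℤ} (h0 : shell n ≠ 0)
    (hn : ∀ j ≤ s, 1 ≤ iterLog j (Real.log 2 * shell n)) :
    decay s ε n ^ 2 ≤
      (((2 : ℝ) ^ shell n) ^ d)⁻¹ * Real.exp (-2 * logRate s ε (Real.log 2 * shell n)) := by
  have h2 : Real.log 2 * shell n ≤ Real.log (latticeNorm n) := by
    rw [mul_comm, ← Real.log_pow]
    exact Real.log_le_log (by positivity) (le_latticeNorm_of_shell h0)
  have h3 := logRate_le_logRate hε hn h2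
  have h4 : (((2 : ℝ) ^ shell n) ^ d)⁻¹ = Real.exp (-(d * (Real.log 2 * shell n))) := by
    rw [Real.exp_neg, mul_comm (Real.log 2), ← Real.log_pow, ← Real.log_pow,
      Real.exp_log (by positivity)]
  rw [h4, ← Real.exp_add, decay, ← Real.exp_nat_mul]
  refine Real.exp_le_exp.2 ?_
  have h5 : (d : ℝ) * (Real.log 2 * shell n) ≤ d * Real.log (latticeNorm n) := by gcongr
  push_cast
  linarith

theorem tsum_shell_le {s : ℕ} {ε : ℝ} (hε : 0 < ε) {k : ℕ} (hk0 : k ≠ 0)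
    (hk : ∀ j ≤ s, 1 ≤ iterLog j (Real.log 2 * k)) :
    ∑' n : {n : Fin d → ℤ | shell n = k}, decay s ε n.1 ^ 2 ≤
      8 ^ d * Real.exp (-2 * logRate s ε (Real.log 2 * k)) := by
  set F := (finite_shell (d := d) k).toFinset with hF
  have hF' : {n : Fin d → ℤ | shell n = k} = F := by simp [hF]
  have hmem : ∀ n ∈ F, shell n = k := fun n hn => by simpa [hF] using hn
  have htsum : ∑' n : {n : Fin d → ℤ | shell n = k}, decay s ε n.1 ^ 2 =
      ∑ n ∈ F, decay s ε n ^ 2 := by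
    rw [hF']
    exact F.tsum_subtype fun n => decay s ε n ^ 2
  have hterm : ∀ n ∈ F, decay s ε n ^ 2 ≤
      (((2 : ℝ) ^ k) ^ d)⁻¹ * Real.exp (-2 * logRate s ε (Real.log 2 * k)) := fun n hn => by
    obtain rfl := hmem n hn
    exact decay_sq_le hε hk0 hk
  rw [htsum]
  refine (Finset.sum_le_card_nsmul _ _ _ hterm).trans ?_
  rw [nsmul_eq_mul]
  refine (mul_le_mul_of_nonneg_right (card_shell_le k F hmem) (by positivity)).trans
    (le_of_eq ?_)
  have h6 : ((2 : ℝ) ^ k) ^ d ≠ 0 := by positivity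
  rw [mul_assoc, ← mul_assoc (((2 : ℝ) ^ k) ^ d), mul_inv_cancel₀ h6, one_mul]

/-- The comparison function is square summable: the shell `k` has at most `8 ^ d * 2 ^ (k d)`
points, and on it `decay ^ 2` is at most `2 ^ (-k d) exp (-2 logRate (k log 2))`. -/
theorem summable_decay_sq (s : ℕ) {ε : ℝ} (hε : 0 < ε) :
    Summable fun n : Fin d → ℤ => decay s ε n ^ 2 := by
  have hlog2 : 0 < Real.log 2 := Real.log_pos (by norm_num)
  have htend : Tendsto (fun k : ℕ => Real.log 2 * (k : ℝ)) atTop atTop :=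
    tendsto_natCast_atTop_atTop.const_mul_atTop hlog2
  refine (summable_partition (fun n => sq_nonneg _) (s := fun k => {n : Fin d → ℤ | shell n = k})
    fun n => ⟨shell n, rfl, fun k hk => hk.symm⟩).2 ⟨fun k => ?_, ?_⟩
  · have := (finite_shell (d := d) k).to_subtype
    exact Summable.of_finite
  · refine Summable.of_norm_bounded_eventually_nat
      ((summable_exp_logRate s hε hlog2).mul_left (8 ^ d)) ?_
    filter_upwards [htend.eventually (eventually_one_le_iterLog s), eventually_ge_atTop 1]
      with k hk hk1
    rw [Real.norm_of_nonneg (tsum_nonneg fun _ => sq_nonneg _)]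
    exact tsum_shell_le hε (Nat.one_le_iff_ne_zero.1 hk1) hk

theorem weightRatio_eq {s : ℕ} {ε : ℝ} {n m : Fin d → ℤ}
    (hn : ∀ i ≤ s, 1 ≤ iterLog i (latticeNorm n)) (hm : ∀ i ≤ s, 1 ≤ iterLog i (latticeNorm m)) :
    weightRatio s ε n m = decay s ε m / decay s ε n := by
  have hn' : ∀ i ≤ s, 0 < iterLog i (latticeNorm n) := fun i hi => zero_lt_one.trans_le (hn i hi)
  have hm' : ∀ i ≤ s, 0 < iterLog i (latticeNorm m) := fun i hi => zero_lt_one.trans_le (hm i hi)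
  have hn0 : 0 < latticeNorm n := hn' 0 (Nat.zero_le s)
  have hm0 : 0 < latticeNorm m := hm' 0 (Nat.zero_le s)
  have hsqrt : ∏ i ∈ Finset.Icc 1 s, √(iterLog i (latticeNorm n) / iterLog i (latticeNorm m)) =
      Real.exp (∑ i ∈ Finset.Icc 1 s, 1 / 2 * (iterLog i (Real.log (latticeNorm n)) -
        iterLog i (Real.log (latticeNorm m)))) := by
    rw [Real.exp_sum]
    refine Finset.prod_congr rfl fun i hi => ?_
    have his := (Finset.mem_Icc.1 hi).2
    rw [iterLog_log, iterLog_log, ← Real.log_div (hn' i his).ne' (hm' i his).ne',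
      Real.sqrt_eq_rpow, Real.rpow_def_of_pos (div_pos (hn' i his) (hm' i his)), mul_comm]
  rw [weightRatio, hsqrt, Real.rpow_def_of_pos (div_pos hn0 hm0),
    Real.rpow_def_of_pos (div_pos (hn' s le_rfl) (hm' s le_rfl)), decay, decay, ← Real.exp_sub,
    ← Real.exp_add, ← Real.exp_add, Real.log_div hn0.ne' hm0.ne',
    Real.log_div (hn' s le_rfl).ne' (hm' s le_rfl).ne', ← iterLog_log, ← iterLog_log]
  congr 1
  unfold logRate
  rw [← Finset.mul_sum, Finset.sum_sub_distrib]
  ring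

/-- The general lower bound is `(Δb)_n / b_n` for the comparison function `b = decay s ε`. -/
theorem generalBound_eq {s : ℕ} {ε : ℝ} {n : Fin d → ℤ}
    (hn : ∀ r, latticeNorm n - 1 ≤ r → ∀ i ≤ s, 1 ≤ iterLog i r) :
    generalBound s ε n = -2 * (d : ℝ) + ∑ j, decay s ε (n + basisVec j) / decay s ε n +
      ∑ j, decay s ε (n - basisVec j) / decay s ε n := by
  have h0 := hn (latticeNorm n) (by linarith)
  simp only [generalBound, weightRatio_eq h0 (hn _ (sub_one_le_latticeNorm_add n _)),
    weightRatio_eq h0 (hn _ (sub_one_le_latticeNorm_sub n _))]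

/-- Under the general lower bound the comparison function is a square summable supersolution off a
box, and a critical operator then has the eigenvalue `0`. -/
theorem IsCriticalAt.zero_mem_pointSpectrum_of_generalBound {V : (Fin d → ℤ) → ℝ}
    (hcrit : IsCriticalAt V 0) {s : ℕ} {ε : ℝ} (hε : 0 < ε) {N : ℝ}
    (hV : ∀ n : Fin d → ℤ, N ≤ latticeNorm n → generalBound s ε n ≤ V n) :
    (0 : ℂ) ∈ pointSpectrum (schrodinger V) := by
  obtain ⟨R₀, hR₀⟩ := eventually_atTop.1 (eventually_one_le_iterLog s)
  obtain ⟨R, hR⟩ := exists_nat_ge (max N (R₀ + 1))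
  set K : Finset (Fin d → ℤ) := Fintype.piFinset fun _ : Fin d => Finset.Icc (-(R : ℤ)) R with hK
  have hout : ∀ n ∉ K, (R : ℝ) ≤ latticeNorm n := fun n hn => by
    by_contra! h
    exact hn (setOf_latticeNorm_le_subset R h.le)
  have hbound : ∀ n ∉ K, -2 * (d : ℝ) + ∑ j, decay s ε (n + basisVec j) / decay s ε n +
      ∑ j, decay s ε (n - basisVec j) / decay s ε n ≤ V n := fun n hn => by
    have h1 := hR.trans (hout n hn)
    rw [← generalBound_eq fun r hr => hR₀ r (by linarith [(le_max_right N (R₀ + 1)).trans h1])]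
    exact hV n ((le_max_left _ _).trans h1)
  have hKne : K.Nonempty := ⟨0, by simp [hK]⟩
  have hsup : ∀ n ∉ K, 0 ≤ realSchrodinger V (decay s ε) n := fun n hn => by
    have hb := decay_pos s ε n
    have h1 := mul_le_mul_of_nonneg_right (hbound n hn) hb.le
    rw [← Finset.sum_div, ← Finset.sum_div, add_mul, add_mul, div_mul_cancel₀ _ hb.ne',
      div_mul_cancel₀ _ hb.ne'] at h1
    simp only [realSchrodinger, Finset.sum_add_distrib, Finset.sum_sub_distrib, Finset.sum_const,
      Finset.card_univ, Fintype.card_fin, nsmul_eq_mul]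
    linarith
  have hM : ∃ M, ∀ n, M ≤ V n := by
    refine ⟨min (K.inf' hKne V) (-2 * d), fun n => ?_⟩
    by_cases hn : n ∈ K
    · exact (min_le_left _ _).trans (Finset.inf'_le _ hn)
    · refine (min_le_right _ _).trans ((hbound n hn).trans' ?_)
      have h1 : ∀ m : Fin d → (Fin d → ℤ), 0 ≤ ∑ j, decay s ε (m j) / decay s ε n := fun m =>
        Finset.sum_nonneg fun j _ => (div_pos (decay_pos s ε _) (decay_pos s ε n)).le
      linarith [h1 fun j => n + basisVec j, h1 fun j => n - basisVec j]
  obtain ⟨M, hM⟩ := hM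
  exact hcrit.zero_mem_pointSpectrum hM hKne (fun n => (decay_pos s ε n).le)
    (fun n _ => decay_pos s ε n) hsup (summable_decay_sq s hε)

end Decay

/-! ### Second order expansions of iterated logarithms -/

section Expansion

theorem iterLogDeriv_pos {s : ℕ} {z : ℝ} (hz : ∀ i ≤ s, 1 ≤ iterLog i z) :
    0 < iterLogDeriv s z :=
  Finset.prod_pos fun i hi =>
    inv_pos.2 (zero_lt_one.trans_le (hz i (Finset.mem_range.1 hi).le))

theorem iterLogDeriv_le_one {s : ℕ} {z : ℝ} (hz : ∀ i ≤ s, 1 ≤ iterLog i z) :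
    iterLogDeriv s z ≤ 1 :=
  Finset.prod_le_one
    (fun i hi => inv_nonneg.2 (zero_le_one.trans (hz i (Finset.mem_range.1 hi).le)))
    fun i hi => inv_le_one_of_one_le₀ (hz i (Finset.mem_range.1 hi).le)

theorem iterLogDeriv_succ_le {s : ℕ} {z : ℝ} (hz : ∀ i ≤ s, 1 ≤ iterLog i z) :
    iterLogDeriv (s + 1) z ≤ z⁻¹ := by
  have hz0 : 0 ≤ z⁻¹ := inv_nonneg.2 (zero_le_one.trans (hz 0 (Nat.zero_le s)))
  rw [iterLogDeriv, Finset.prod_range_succ']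
  refine mul_le_of_le_one_left hz0 (Finset.prod_le_one (fun i hi => ?_) fun i hi => ?_)
  · exact inv_nonneg.2 (zero_le_one.trans (hz _ (Finset.mem_range.1 hi)))
  · exact inv_le_one_of_one_le₀ (hz _ (Finset.mem_range.1 hi))

theorem iterLogDeriv_succ' (s : ℕ) (z : ℝ) :
    iterLogDeriv (s + 1) z = iterLogDeriv s (Real.log z) * z⁻¹ := by
  rw [iterLogDeriv, Finset.prod_range_succ']
  rfl

/-- The product `∏_{i < s} log_i z` is of smaller order than `z ^ 2`. -/
theorem tendsto_iterLogDeriv_inv_div_sq (s : ℕ) :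
    Tendsto (fun z => (iterLogDeriv s z)⁻¹ / z ^ 2) atTop (𝓝 0) := by
  induction s with
  | zero =>
    simp only [iterLogDeriv, Finset.range_zero, Finset.prod_empty, inv_one]
    exact tendsto_const_nhds.div_atTop (tendsto_pow_atTop two_ne_zero)
  | succ s ih =>
    have h1 : Tendsto (fun z : ℝ => Real.log z ^ 2 / z) atTop (𝓝 0) :=
      (Real.isLittleO_pow_log_id_atTop (n := 2)).tendsto_div_nhds_zero
    have h2 := (ih.comp Real.tendsto_log_atTop).mul h1
    rw [zero_mul] at h2
    refine h2.congr' ?_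
    filter_upwards [eventually_gt_atTop 1] with z hz
    have hz0 : z ≠ 0 := by positivity
    have hl : Real.log z ≠ 0 := (Real.log_pos hz).ne'
    rw [iterLogDeriv_succ', mul_inv, inv_inv, Function.comp_apply]
    field_simp

theorem eventually_inv_sq_le (s : ℕ) {κ : ℝ} (hκ : 0 < κ) :
    ∀ᶠ z in atTop, (z ^ 2)⁻¹ ≤ κ * iterLogDeriv s z := by
  filter_upwards [(tendsto_iterLogDeriv_inv_div_sq s).eventually_le_const hκ,
    eventually_one_le_iterLog s] with z hz h1
  have hD := iterLogDeriv_pos h1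
  rwa [div_eq_mul_inv, inv_mul_le_iff₀ hD, mul_comm] at hz

theorem le_log_add {w σ : ℝ} (hw : 0 < w) (hσ : |σ / w| ≤ 1 / 2) :
    Real.log w + σ / w - 2 * (σ / w) ^ 2 ≤ Real.log (w + σ) := by
  set x := σ / w with hx
  have hx1 := (abs_le.1 hσ).1
  have h0 : 0 < 1 + x := by linarith
  have h1 : w + σ = w * (1 + x) := by rw [hx]; field_simp
  rw [h1, Real.log_mul hw.ne' h0.ne']
  have h2 : x - 2 * x ^ 2 ≤ 1 - (1 + x)⁻¹ := by
    have h3 : 1 - (1 + x)⁻¹ = x / (1 + x) := by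
      field_simp
      ring
    rw [h3, le_div_iff₀ h0]
    nlinarith [mul_nonneg (sq_nonneg x) (by linarith : 0 ≤ 1 + 2 * x)]
  linarith [Real.one_sub_inv_le_log_of_pos h0]

/-- Second order lower bound for an iterated logarithm. The error is of order `(τ / z) ^ 2` for
every `i`, since `1 / z` bounds the derivative of each proper iterated logarithm. -/
theorem exists_iterLog_expansion (i : ℕ) : ∃ C, 0 ≤ C ∧ ∀ᶠ z in atTop, ∀ τ, |τ| ≤ 1 →
    iterLog i z + iterLogDeriv i z * τ - C * (τ / z) ^ 2 ≤ iterLog i (z + τ) := by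
  induction i with
  | zero => exact ⟨0, le_rfl, Eventually.of_forall fun z τ _ => by simp [iterLogDeriv]⟩
  | succ i ih =>
    obtain ⟨C, hC, ih⟩ := ih
    refine ⟨C + 2 * (1 + C) ^ 2, by positivity, ?_⟩
    filter_upwards [ih, eventually_one_le_iterLog i, eventually_ge_atTop (2 * (1 + C))]
      with z hz h1 hzC τ hτ
    have hz1 : 1 ≤ z := h1 0 (Nat.zero_le i)
    have hz0 : 0 < z := zero_lt_one.trans_le hz1
    set w := iterLog i z with hw
    have hw1 : 1 ≤ w := h1 i le_rfl
    have hw0 : 0 < w := zero_lt_one.trans_le hw1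
    set σ := iterLogDeriv i z * τ - C * (τ / z) ^ 2 with hσ
    have hD : σ / w = iterLogDeriv (i + 1) z * τ - C * (τ / z) ^ 2 / w := by
      rw [hσ, iterLogDeriv_succ, ← hw]
      field_simp
    have hq : C * (τ / z) ^ 2 / w ≤ C * (τ / z) ^ 2 := div_le_self (by positivity) hw1
    have hq0 : 0 ≤ C * (τ / z) ^ 2 / w := by positivity
    have hDpos : 0 ≤ iterLogDeriv (i + 1) z := by
      rw [iterLogDeriv_succ]
      exact mul_nonneg (iterLogDeriv_pos h1).le (inv_nonneg.2 hw0.le)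
    have hτz : |τ / z| ≤ 1 := by
      rw [abs_div, abs_of_pos hz0, div_le_one hz0]
      linarith
    have hσw : |σ / w| ≤ (1 + C) * |τ / z| := by
      have h2 : |iterLogDeriv (i + 1) z * τ| ≤ |τ / z| := by
        rw [abs_mul, abs_of_nonneg hDpos, abs_div, abs_of_pos hz0, div_eq_inv_mul]
        exact mul_le_mul_of_nonneg_right (iterLogDeriv_succ_le h1) (abs_nonneg τ)
      have h3 : C * (τ / z) ^ 2 ≤ C * |τ / z| := by
        rw [← sq_abs]
        exact mul_le_mul_of_nonneg_left
          (by nlinarith [abs_nonneg (τ / z)]) hC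
      rw [hD]
      refine (abs_sub _ _).trans ?_
      rw [abs_of_nonneg hq0]
      linarith
    have hhalf : (1 + C) * |τ / z| ≤ 1 / 2 := by
      rw [abs_div, abs_of_pos hz0, ← mul_div_assoc, div_le_iff₀ hz0]
      nlinarith [abs_nonneg τ]
    have hlog := le_log_add hw0 (hσw.trans hhalf)
    have hσw2 : (σ / w) ^ 2 ≤ (1 + C) ^ 2 * (τ / z) ^ 2 := by
      rw [← mul_pow]
      refine sq_le_sq.2 ?_
      rwa [abs_mul, abs_of_nonneg (by positivity : 0 ≤ 1 + C)]
    have hpos : 0 < w + σ := by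
      have h2 : -(1 / 2) ≤ σ / w := (abs_le.1 (hσw.trans hhalf)).1
      rw [le_div_iff₀ hw0] at h2
      linarith
    have hmono : Real.log (w + σ) ≤ Real.log (iterLog i (z + τ)) :=
      Real.log_le_log hpos (by linarith [hz τ hτ])
    rw [iterLog_succ, iterLog_succ, ← hw]
    linarith

/-- The derivative of `logRate s ε`. -/
def logRateDeriv (s : ℕ) (ε z : ℝ) : ℝ :=
  1 / 2 * ∑ i ∈ Finset.Icc 1 s, iterLogDeriv i z + ε * iterLogDeriv s z

theorem exists_logRate_expansion (s : ℕ) {ε : ℝ} (hε : 0 < ε) : ∃ C, 0 ≤ C ∧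
    ∀ᶠ z in atTop, ∀ τ, |τ| ≤ 1 →
      logRate s ε z + logRateDeriv s ε z * τ - C * (τ / z) ^ 2 ≤ logRate s ε (z + τ) := by
  choose C hC hexp using exists_iterLog_expansion
  refine ⟨1 / 2 * ∑ i ∈ Finset.Icc 1 s, C i + ε * C s,
    add_nonneg (mul_nonneg (by norm_num) (Finset.sum_nonneg fun i _ => hC i))
      (mul_nonneg hε.le (hC s)), ?_⟩
  have h : ∀ᶠ z in atTop, ∀ i ∈ Finset.Icc 1 s, ∀ τ, |τ| ≤ 1 →
      iterLog i z + iterLogDeriv i z * τ - C i * (τ / z) ^ 2 ≤ iterLog i (z + τ) :=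
    (Finset.eventually_all _).2 fun i _ => hexp i
  filter_upwards [h, hexp s] with z h1 h2 τ hτ
  have h3 := Finset.sum_le_sum fun i hi => h1 i hi τ hτ
  have h4 := mul_le_mul_of_nonneg_left (h2 τ hτ) hε.le
  rw [Finset.sum_sub_distrib, Finset.sum_add_distrib, ← Finset.sum_mul, ← Finset.sum_mul] at h3
  unfold logRate logRateDeriv
  linarith

theorem logRateDeriv_nonneg {s : ℕ} {ε z : ℝ} (hε : 0 < ε) (hz : ∀ i ≤ s, 1 ≤ iterLog i z) :
    0 ≤ logRateDeriv s ε z :=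
  add_nonneg (mul_nonneg (by norm_num) (Finset.sum_nonneg fun _ hi =>
    (iterLogDeriv_pos fun j hj => hz j (hj.trans (Finset.mem_Icc.1 hi).2)).le))
    (mul_nonneg hε.le (iterLogDeriv_pos hz).le)

theorem logRateDeriv_le {s : ℕ} {ε z : ℝ} (hz : ∀ i ≤ s, 1 ≤ iterLog i z) :
    logRateDeriv s ε z ≤ s / 2 * z⁻¹ + ε * iterLogDeriv s z := by
  have h : ∑ i ∈ Finset.Icc 1 s, iterLogDeriv i z ≤ ∑ i ∈ Finset.Icc 1 s, z⁻¹ :=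
    Finset.sum_le_sum fun i hi => by
      obtain ⟨k, rfl⟩ := Nat.exists_eq_succ_of_ne_zero
        (Nat.one_le_iff_ne_zero.1 (Finset.mem_Icc.1 hi).1)
      exact iterLogDeriv_succ_le fun j hj => hz j (hj.trans
        ((Nat.le_succ k).trans (Finset.mem_Icc.1 hi).2))
  rw [Finset.sum_const, Nat.card_Icc, nsmul_eq_mul, Nat.add_sub_cancel] at h
  unfold logRateDeriv
  linarith

end Expansion

/-! ### The discrete Laplacian of the comparison function -/

section Laplacian

theorem log_one_add_bounds {x : ℝ} (hx : |x| ≤ 1 / 2) :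
    |Real.log (1 + x) - (x - x ^ 2 / 2)| ≤ 2 * |x| ^ 3 ∧ |Real.log (1 + x)| ≤ 2 * |x| ∧
      |Real.log (1 + x) ^ 2 - x ^ 2| ≤ 6 * |x| ^ 3 := by
  set y := |x| with hy
  set l := Real.log (1 + x) with hl
  have hy0 : 0 ≤ y := abs_nonneg x
  have hxy : x ^ 2 = y ^ 2 := (sq_abs x).symm
  have hl2 : |l - (x - x ^ 2 / 2)| ≤ 2 * y ^ 3 := by
    have h := Real.abs_log_sub_add_sum_range_le (x := -x) (by rw [abs_neg]; linarith) 2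
    have h1 : (∑ i ∈ Finset.range 2, (-x) ^ (i + 1) / ((i : ℝ) + 1)) + Real.log (1 - -x) =
        l - (x - x ^ 2 / 2) := by
      rw [hl, sub_neg_eq_add]
      norm_num [Finset.sum_range_succ]
      ring
    rw [h1, abs_neg, ← hy] at h
    refine h.trans ?_
    rw [div_le_iff₀ (by linarith)]
    have h2 : 0 ≤ y ^ 3 * (1 - 2 * y) := mul_nonneg (pow_nonneg hy0 3) (by linarith)
    calc y ^ (2 + 1) = 2 * y ^ 3 * (1 - y) - y ^ 3 * (1 - 2 * y) := by ring
      _ ≤ 2 * y ^ 3 * (1 - y) := by linarith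
  have hy3 : y ^ 3 ≤ y ^ 2 / 2 := by
    calc y ^ 3 = y ^ 2 * y := by ring
      _ ≤ y ^ 2 * (1 / 2) := by gcongr
      _ = y ^ 2 / 2 := by ring
  have hl1 : |l - x| ≤ 2 * y ^ 2 := by
    have h := abs_le.1 hl2
    rw [hxy] at h
    rw [abs_le]
    constructor <;> linarith [h.1, h.2, sq_nonneg y]
  have hl0 : |l| ≤ 2 * y := by
    have h := abs_sub_abs_le_abs_sub l x
    have h1 : y ^ 2 ≤ y / 2 := by nlinarith
    linarith
  refine ⟨hl2, hl0, ?_⟩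
  have h : l ^ 2 - x ^ 2 = (l - x) * (l + x) := by ring
  rw [h, abs_mul]
  have h2 : |l + x| ≤ 3 * y := (abs_add_le l x).trans (by linarith)
  calc |l - x| * |l + x| ≤ 2 * y ^ 2 * (3 * y) := by gcongr
    _ = 6 * y ^ 3 := by ring

theorem exp_le_cubic {u : ℝ} (hu : |u| ≤ 1) : Real.exp u ≤ 1 + u + u ^ 2 / 2 + |u| ^ 3 := by
  have h := (abs_le.1 (Real.exp_bound hu (n := 3) (by norm_num))).2
  norm_num [Finset.sum_range_succ, Nat.factorial] at h
  linarith [pow_nonneg (abs_nonneg u) 3]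

/-- Second order expansion, with a uniform cubic error, of the ratio of the values of the comparison
function at neighbouring points; `1 + x` stands for the ratio of their squared norms. -/
theorem exp_log_le {a₀ a M x : ℝ} (ha : 0 ≤ a) (ha₀ : a ≤ a₀) (hM : 0 ≤ M) (hM1 : M ≤ 1)
    (hx : (a₀ + 1) * |x| ≤ 1 / 2) :
    Real.exp (-(a * (Real.log (1 + x) / 2)) + M * (Real.log (1 + x) / 2) ^ 2) ≤
      1 - a / 2 * x + (a / 4 + a ^ 2 / 8 + M / 4) * x ^ 2 + 10 * (a₀ + 1) ^ 3 * |x| ^ 3 := by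
  set y := |x| with hy
  set l := Real.log (1 + x) with hl
  set b := a₀ + 1 with hb
  have hy0 : 0 ≤ y := abs_nonneg x
  have hb1 : 1 ≤ b := by linarith
  have hab : a ≤ b := by linarith
  have hy2 : y ≤ 1 / 2 := (le_mul_of_one_le_left hy0 hb1).trans hx
  have hyy : y ^ 2 ≤ y := pow_le_of_le_one hy0 (by linarith) two_ne_zero
  have hy3 : 0 ≤ y ^ 3 := pow_nonneg hy0 3
  obtain ⟨hl2, hl0, hlsq⟩ := log_one_add_bounds hy2
  rw [← hl, ← hy] at hl2 hl0 hlsq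
  set u := -(a * (l / 2)) + M * (l / 2) ^ 2 with hu
  have hMl0 : 0 ≤ M * (l / 2) ^ 2 := by positivity
  have hMl : M * (l / 2) ^ 2 ≤ y ^ 2 := by
    have h1 : |l / 2| ≤ y := by
      rw [abs_div, abs_two]
      linarith
    calc M * (l / 2) ^ 2 ≤ 1 * (l / 2) ^ 2 := by gcongr
      _ = |l / 2| ^ 2 := by rw [one_mul, sq_abs]
      _ ≤ y ^ 2 := by gcongr
  have hal : |a * (l / 2)| ≤ a * y := by
    rw [abs_mul, abs_of_nonneg ha, abs_div, abs_two]
    exact mul_le_mul_of_nonneg_left (by linarith) ha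
  have hay : a * y + y ≤ b * y := by
    have := mul_le_mul_of_nonneg_right ha₀ hy0
    rw [hb, add_mul]
    linarith
  have hub : |u| ≤ b * y := by
    have h1 := abs_add_le (-(a * (l / 2))) (M * (l / 2) ^ 2)
    rw [abs_neg, abs_of_nonneg hMl0] at h1
    linarith
  have hu3 : |u| ^ 3 ≤ b ^ 3 * y ^ 3 := by
    rw [← mul_pow]
    exact pow_le_pow_left₀ (abs_nonneg u) hub 3
  have hfirst : u ≤ -(a / 2) * x + (a / 4 + M / 4) * x ^ 2 + (b + 3 / 2) * y ^ 3 := by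
    have h1 := mul_le_mul_of_nonneg_left (neg_le_of_abs_le hl2) ha
    have h2 := mul_le_mul_of_nonneg_left (le_of_abs_le hlsq) hM
    have h3 : M * (6 * y ^ 3) ≤ 6 * y ^ 3 := mul_le_of_le_one_left (by linarith) hM1
    have h4 : a * y ^ 3 ≤ b * y ^ 3 := mul_le_mul_of_nonneg_right hab hy3
    rw [hu]
    linarith
  have hsecond : u ^ 2 ≤ a ^ 2 / 4 * x ^ 2 + (3 / 2 * b ^ 2 + 2 * b + 1) * y ^ 3 := by
    have h1 : u ^ 2 = a ^ 2 / 4 * l ^ 2 + 2 * (-(a * (l / 2)) * (M * (l / 2) ^ 2)) +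
        (M * (l / 2) ^ 2) ^ 2 := by rw [hu]; ring
    have h2 := mul_le_mul_of_nonneg_left (le_of_abs_le hlsq) (by positivity : 0 ≤ a ^ 2 / 4)
    have h4 : a ^ 2 / 4 * (6 * y ^ 3) ≤ b ^ 2 / 4 * (6 * y ^ 3) := by gcongr
    have h5 : -(a * (l / 2)) * (M * (l / 2) ^ 2) ≤ b * y ^ 3 := by
      have h6 : -(a * (l / 2)) ≤ b * y :=
        (neg_le_abs _).trans (hal.trans (mul_le_mul_of_nonneg_right hab hy0))
      calc -(a * (l / 2)) * (M * (l / 2) ^ 2) ≤ b * y * (M * (l / 2) ^ 2) :=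
            mul_le_mul_of_nonneg_right h6 hMl0
        _ ≤ b * y * y ^ 2 := mul_le_mul_of_nonneg_left hMl (by positivity)
        _ = b * y ^ 3 := by ring
    have h7 : (M * (l / 2) ^ 2) ^ 2 ≤ y ^ 3 := by
      calc (M * (l / 2) ^ 2) ^ 2 ≤ (y ^ 2) ^ 2 := pow_le_pow_left₀ hMl0 hMl 2
        _ = y ^ 3 * y := by ring
        _ ≤ y ^ 3 := mul_le_of_le_one_right hy3 (by linarith)
    rw [h1]
    linarith
  have hconst : (b + 3 / 2) * y ^ 3 + (3 / 2 * b ^ 2 + 2 * b + 1) * y ^ 3 / 2 + b ^ 3 * y ^ 3 ≤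
      10 * b ^ 3 * y ^ 3 := by
    have hb3 : b ≤ b ^ 3 := le_self_pow₀ hb1 (by norm_num)
    have hb2 : b ^ 2 ≤ b ^ 3 := pow_le_pow_right₀ hb1 (by norm_num)
    have hb31 : 1 ≤ b ^ 3 := one_le_pow₀ hb1
    have h1 : b + 3 / 2 + (3 / 2 * b ^ 2 + 2 * b + 1) / 2 + b ^ 3 ≤ 10 * b ^ 3 := by linarith
    linarith [mul_le_mul_of_nonneg_right h1 hy3]
  linarith [exp_le_cubic (hub.trans (by linarith))]

variable {d : ℕ}

theorem log_latticeNorm_eq {n m : Fin d → ℤ} {h : ℝ} (hn : 0 < latticeNorm n)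
    (hm : 0 < latticeNorm m) (hsq : latticeNorm m ^ 2 = latticeNorm n ^ 2 + h) :
    Real.log (latticeNorm m) =
      Real.log (latticeNorm n) + Real.log (1 + h / latticeNorm n ^ 2) / 2 := by
  have h1 : 1 + h / latticeNorm n ^ 2 = (latticeNorm m / latticeNorm n) ^ 2 := by
    rw [div_pow, hsq]
    field_simp
  rw [h1, Real.log_pow, Real.log_div hm.ne' hn.ne']
  push_cast
  ring

/-- The sum over the nearest neighbours of the expansion in `exp_log_le`: the linear terms add up
to `2d / |n|²` and the quadratic ones to `8 / |n|² + 2d / |n|⁴`. -/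
theorem sum_neighbours_le {a₀ a M : ℝ} (ha : 0 ≤ a) (ha₀ : a ≤ a₀) (hM1 : M ≤ 1)
    {n : Fin d → ℤ} (hn : 1 ≤ latticeNorm n) {f : ℝ → ℝ}
    (hf : ∀ x, |x| ≤ 3 / latticeNorm n → f x ≤ 1 - a / 2 * x +
      (a / 4 + a ^ 2 / 8 + M / 4) * x ^ 2 + 10 * (a₀ + 1) ^ 3 * |x| ^ 3) :
    -2 * (d : ℝ) + ∑ j, f ((2 * n j + 1) / latticeNorm n ^ 2) +
        ∑ j, f ((-2 * n j + 1) / latticeNorm n ^ 2) ≤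
      1 / latticeNorm n ^ 2 * (a ^ 2 - (d - 2) * a + 2 * M) +
        542 * d * (a₀ + 1) ^ 3 / latticeNorm n ^ 3 := by
  set r := latticeNorm n with hr
  set b := a₀ + 1 with hb
  set B := a / 4 + a ^ 2 / 8 + M / 4 with hB
  have hr0 : 0 < r := zero_lt_one.trans_le hn
  have hb1 : 1 ≤ b := by linarith
  have hsmall : ∀ j, |(2 * n j + 1) / r ^ 2| ≤ 3 / r ∧ |(-2 * n j + 1) / r ^ 2| ≤ 3 / r := by
    intro j
    have h1 := abs_le.1 (abs_coord_le_latticeNorm n j)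
    rw [← hr] at h1
    have h2 : 3 / r = 3 * r / r ^ 2 := by field_simp
    rw [abs_div, abs_div, abs_of_pos (pow_pos hr0 2), h2]
    constructor
    · gcongr
      rw [abs_le]
      constructor <;> linarith
    · gcongr
      rw [abs_le]
      constructor <;> linarith
  have hcube : ∀ x, |x| ≤ 3 / r → 10 * b ^ 3 * |x| ^ 3 ≤ 270 * b ^ 3 / r ^ 3 := by
    intro x hx
    calc 10 * b ^ 3 * |x| ^ 3 ≤ 10 * b ^ 3 * (3 / r) ^ 3 := by gcongr
      _ = 270 * b ^ 3 / r ^ 3 := by rw [div_pow]; ring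
  have hpair : ∀ j, f ((2 * n j + 1) / r ^ 2) + f ((-2 * n j + 1) / r ^ 2) ≤
      2 - a / r ^ 2 + 2 * B / r ^ 4 + 540 * b ^ 3 / r ^ 3 + 8 * B / r ^ 4 * (n j : ℝ) ^ 2 := by
    intro j
    have h1 := hf _ (hsmall j).1
    have h2 := hf _ (hsmall j).2
    have h3 := hcube _ (hsmall j).1
    have h4 := hcube _ (hsmall j).2
    have h5 : 1 - a / 2 * ((2 * n j + 1) / r ^ 2) + B * ((2 * n j + 1) / r ^ 2) ^ 2 +
        (1 - a / 2 * ((-2 * n j + 1) / r ^ 2) + B * ((-2 * n j + 1) / r ^ 2) ^ 2) +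
          (270 * b ^ 3 / r ^ 3 + 270 * b ^ 3 / r ^ 3) =
        2 - a / r ^ 2 + 2 * B / r ^ 4 + 540 * b ^ 3 / r ^ 3 + 8 * B / r ^ 4 * (n j : ℝ) ^ 2 := by
      field_simp
      ring
    linarith
  have hsum := Finset.sum_le_sum fun j (_ : j ∈ Finset.univ) => hpair j
  rw [Finset.sum_add_distrib, Finset.sum_add_distrib, ← Finset.mul_sum, ← latticeNorm_sq, ← hr,
    Finset.sum_const, Finset.card_univ, Fintype.card_fin, nsmul_eq_mul] at hsum
  have hBb : 2 * B ≤ 2 * b ^ 3 := by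
    have h1 : a ≤ b := by linarith
    have h2 : a ^ 2 ≤ b ^ 2 := pow_le_pow_left₀ ha h1 2
    have hb3 : b ≤ b ^ 3 := le_self_pow₀ hb1 (by norm_num)
    have hb2 : b ^ 2 ≤ b ^ 3 := pow_le_pow_right₀ hb1 (by norm_num)
    have hb31 : 1 ≤ b ^ 3 := one_le_pow₀ hb1
    linarith
  have hquart : 2 * B / r ^ 4 ≤ 2 * b ^ 3 / r ^ 3 := by
    calc 2 * B / r ^ 4 ≤ 2 * b ^ 3 / r ^ 4 := by gcongr
      _ ≤ 2 * b ^ 3 / r ^ 3 := by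
        gcongr
        · norm_num
  have hfinal : -2 * (d : ℝ) + (d * (2 - a / r ^ 2 + 2 * b ^ 3 / r ^ 3 + 540 * b ^ 3 / r ^ 3) +
      8 * B / r ^ 4 * r ^ 2) =
      1 / r ^ 2 * (a ^ 2 - (d - 2) * a + 2 * M) + 542 * d * b ^ 3 / r ^ 3 := by
    rw [hB]
    field_simp
    ring
  have hd := mul_le_mul_of_nonneg_left hquart (Nat.cast_nonneg (α := ℝ) d)
  linarith

/-- Upper bound for `(Δb)_n / b_n` with the comparison function `b = decay s ε`. In terms of
`a = d / 2 + logRateDeriv s ε (log |n|)` the leading term is `(a² - (d - 2) a) / |n|²`, which is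
the continuous expression `(b'' + (d - 1) b' / r) / b` without the derivative of `a`; the latter
is of order `(|n| log |n|)⁻²`. -/
theorem exists_generalBound_le (s : ℕ) {ε : ℝ} (hε : 0 < ε) : ∃ C, 0 ≤ C ∧ ∀ᶠ z in atTop,
    ∀ n : Fin d → ℤ, Real.log (latticeNorm n) = z → generalBound s ε n ≤
      1 / latticeNorm n ^ 2 * ((d : ℝ) * (4 - d) / 4 + 2 * logRateDeriv s ε z +
        logRateDeriv s ε z ^ 2 + C * (z ^ 2)⁻¹) + C / latticeNorm n ^ 3 := by
  obtain ⟨C, hC, hexp⟩ := exists_logRate_expansion s hε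
  set a₀ : ℝ := d / 2 + (s / 2 + ε) with ha₀
  have ha₀0 : 0 ≤ a₀ := by positivity
  refine ⟨2 * C + 542 * d * (a₀ + 1) ^ 3, by positivity, ?_⟩
  obtain ⟨R, hR⟩ := eventually_atTop.1 (eventually_one_le_iterLog s)
  filter_upwards [hexp, eventually_one_le_iterLog s, eventually_ge_atTop (C + 1),
    Real.tendsto_exp_atTop.eventually_ge_atTop (max (R + 1) (6 * (a₀ + 1)))]
    with z hz h1 hzC hexpz n hnz
  have hz1 : 1 ≤ z := h1 0 (Nat.zero_le s)
  have hz0 : 0 < z := zero_lt_one.trans_le hz1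
  set r := latticeNorm n with hr
  have hr0 : 0 < r := by
    rcases (latticeNorm_nonneg n).eq_or_lt with h | h
    · rw [hr, ← h, Real.log_zero] at hnz
      linarith
    · exact h
  have hrz : r = Real.exp z := by rw [← hnz, Real.exp_log hr0]
  rw [← hrz] at hexpz
  have hrR := (le_max_left _ _).trans hexpz
  have hr6 := (le_max_right _ _).trans hexpz
  have hr1 : 1 < r := by linarith
  set A := logRateDeriv s ε z with hA
  have hA0 : 0 ≤ A := logRateDeriv_nonneg hε h1
  have hAa : A ≤ s / 2 + ε := by
    refine (logRateDeriv_le h1).trans ?_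
    have h2 : (s : ℝ) / 2 * z⁻¹ ≤ s / 2 :=
      mul_le_of_le_one_right (by positivity) (inv_le_one_of_one_le₀ hz1)
    have h3 := mul_le_of_le_one_right hε.le (iterLogDeriv_le_one h1)
    linarith
  set a := d / 2 + A with ha
  set M := C * (z ^ 2)⁻¹ with hM
  have hM0 : 0 ≤ M := by positivity
  have hM1 : M ≤ 1 := by
    rw [hM, ← div_eq_mul_inv, div_le_one (by positivity)]
    nlinarith
  set f : ℝ → ℝ := fun x =>
    Real.exp (-(a * (Real.log (1 + x) / 2)) + M * (Real.log (1 + x) / 2) ^ 2) with hf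
  have hx3 : ∀ x, |x| ≤ 3 / r → (a₀ + 1) * |x| ≤ 1 / 2 := fun x hx => by
    rw [le_div_iff₀ hr0] at hx
    have h2 : 6 * (a₀ + 1) * |x| ≤ r * |x| := mul_le_mul_of_nonneg_right hr6 (abs_nonneg x)
    linarith
  have hfx : ∀ x, |x| ≤ 3 / r → f x ≤ 1 - a / 2 * x +
      (a / 4 + a ^ 2 / 8 + M / 4) * x ^ 2 + 10 * (a₀ + 1) ^ 3 * |x| ^ 3 := fun x hx =>
    exp_log_le (by positivity) (by rw [ha, ha₀]; linarith) hM0 hM1 (hx3 x hx)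
  have hratio : ∀ (m : Fin d → ℤ) (h : ℝ), 0 < latticeNorm m → |h| ≤ 3 * r →
      latticeNorm m ^ 2 = r ^ 2 + h → decay s ε m / decay s ε n ≤ f (h / r ^ 2) := by
    intro m h hm hh hsq
    have hx : |h / r ^ 2| ≤ 3 / r := by
      rw [abs_div, abs_of_pos (pow_pos hr0 2), div_le_div_iff₀ (pow_pos hr0 2) hr0]
      calc |h| * r ≤ 3 * r * r := by gcongr
        _ = 3 * r ^ 2 := by ring
    have hx2 : |h / r ^ 2| ≤ 1 / 2 := by
      refine le_trans (le_mul_of_one_le_left (abs_nonneg _) ?_) (hx3 _ hx)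
      linarith
    have hτ : |Real.log (1 + h / r ^ 2) / 2| ≤ 1 := by
      rw [abs_div, abs_two]
      linarith [(log_one_add_bounds hx2).2.1]
    rw [decay, decay, ← Real.exp_sub, log_latticeNorm_eq hr0 hm hsq, ← hr, hnz]
    refine Real.exp_le_exp.2 ?_
    have h2 := hz _ hτ
    rw [div_pow _ z, div_eq_mul_inv _ (z ^ 2)] at h2
    rw [ha, hM]
    linarith
  have hcoord : ∀ j, |(2 * n j + 1 : ℝ)| ≤ 3 * r ∧ |(-2 * n j + 1 : ℝ)| ≤ 3 * r := fun j => by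
    have h2 := abs_le.1 (abs_coord_le_latticeNorm n j)
    rw [← hr] at h2
    constructor <;> rw [abs_le] <;> constructor <;> linarith
  rw [generalBound_eq fun t ht => hR t (by linarith)]
  have hplus : ∑ j, decay s ε (n + basisVec j) / decay s ε n ≤
      ∑ j, f ((2 * n j + 1) / r ^ 2) := Finset.sum_le_sum fun j _ =>
    hratio _ _ (lt_of_lt_of_le (by linarith) (sub_one_le_latticeNorm_add n j)) (hcoord j).1
      (latticeNorm_add_basisVec_sq n j)
  have hminus : ∑ j, decay s ε (n - basisVec j) / decay s ε n ≤
      ∑ j, f ((-2 * n j + 1) / r ^ 2) := Finset.sum_le_sum fun j _ =>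
    hratio _ _ (lt_of_lt_of_le (by linarith) (sub_one_le_latticeNorm_sub n j)) (hcoord j).2
      (latticeNorm_sub_basisVec_sq n j)
  have hmain := sum_neighbours_le (by positivity) (by rw [ha, ha₀]; linarith) hM1 hr1.le hfx
  rw [← hr] at hmain
  have hlead : a ^ 2 - (d - 2) * a + 2 * M =
      (d : ℝ) * (4 - d) / 4 + 2 * A + A ^ 2 + 2 * C * (z ^ 2)⁻¹ := by
    rw [ha, hM]
    ring
  rw [hlead] at hmain
  have hz2 : (0 : ℝ) ≤ (z ^ 2)⁻¹ := by positivity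
  have hconst : 0 ≤ 542 * d * (a₀ + 1) ^ 3 := by positivity
  calc -2 * (d : ℝ) + ∑ j, decay s ε (n + basisVec j) / decay s ε n +
        ∑ j, decay s ε (n - basisVec j) / decay s ε n
      ≤ 1 / r ^ 2 * ((d : ℝ) * (4 - d) / 4 + 2 * A + A ^ 2 + 2 * C * (z ^ 2)⁻¹) +
        542 * d * (a₀ + 1) ^ 3 / r ^ 3 := by linarith
    _ ≤ 1 / r ^ 2 * ((d : ℝ) * (4 - d) / 4 + 2 * A + A ^ 2 +
        (2 * C + 542 * d * (a₀ + 1) ^ 3) * (z ^ 2)⁻¹) +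
        (2 * C + 542 * d * (a₀ + 1) ^ 3) / r ^ 3 := by
      gcongr
      · linarith
      · linarith

theorem prod_Icc_iterLog (j : ℕ) (r : ℝ) :
    ∏ k ∈ Finset.Icc 1 j, 1 / iterLog k r = iterLogDeriv j (Real.log r) := by
  induction j with
  | zero => simp [iterLogDeriv]
  | succ j ih =>
    rw [Finset.prod_Icc_succ_top (by omega), ih, iterLogDeriv_succ, iterLog_log, ← iterLog_succ,
      one_div]

theorem explicitBound_eq (s : ℕ) (ε : ℝ) (n : Fin d → ℤ) : explicitBound s ε n =
    1 / latticeNorm n ^ 2 * ((d : ℝ) * (4 - d) / 4 +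
      ∑ j ∈ Finset.Icc 1 s, iterLogDeriv j (Real.log (latticeNorm n)) +
        ε * iterLogDeriv s (Real.log (latticeNorm n))) := by
  simp only [explicitBound, prod_Icc_iterLog]
  rw [mul_comm 4, ← div_div]
  ring

/-- The explicit bound dominates the general bound with a smaller `ε` near infinity. -/
theorem exists_generalBound_le_explicitBound (s : ℕ) {ε : ℝ} (hε : 0 < ε) : ∃ ε', 0 < ε' ∧
    ∃ N : ℝ, ∀ n : Fin d → ℤ, N ≤ latticeNorm n → generalBound s ε' n ≤ explicitBound s ε n := by
  -- With `ε' ≤ 1` and `8 ε' ≤ ε`, the contributions `2 ε' D` and `2 (ε' D)²` of the last term of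
  -- the logarithmic derivative, `D ≤ 1`, use up half of `ε D`; the rest is of order `z⁻² = o(D)`.
  set ε' := min 1 (ε / 8) with hε'
  have hε'0 : 0 < ε' := lt_min one_pos (by linarith)
  have hε'1 : ε' ≤ 1 := min_le_left _ _
  have hε'8 : ε' ≤ ε / 8 := min_le_right _ _
  obtain ⟨C, hC, hgen⟩ := exists_generalBound_le (d := d) s hε'0
  set κ := ε / 2 / ((s : ℝ) ^ 2 / 2 + 3 * C + 1) with hκ
  have hden : 0 < (s : ℝ) ^ 2 / 2 + 3 * C + 1 := by positivity
  have hκ0 : 0 < κ := by positivity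
  have hev : ∀ᶠ z in atTop, ∀ n : Fin d → ℤ, Real.log (latticeNorm n) = z →
      generalBound s ε' n ≤ explicitBound s ε n := by
    filter_upwards [hgen, eventually_one_le_iterLog s, eventually_inv_sq_le s hκ0]
      with z hz h1 hκz n hnz
    have hz1 : 1 ≤ z := h1 0 (Nat.zero_le s)
    have hz0 : 0 < z := zero_lt_one.trans_le hz1
    refine (hz n hnz).trans ?_
    rw [explicitBound_eq, hnz]
    set r := latticeNorm n with hr
    set D := iterLogDeriv s z with hD
    have hD0 : 0 < D := iterLogDeriv_pos h1
    have hD1 : D ≤ 1 := iterLogDeriv_le_one h1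
    have hr0 : 0 < r := by
      rcases (latticeNorm_nonneg n).eq_or_lt with h | h
      · rw [hr, ← h, Real.log_zero] at hnz
        linarith
      · exact h
    have hrz : r = Real.exp z := by rw [← hnz, Real.exp_log hr0]
    have hrinv : r⁻¹ ≤ 2 * (z ^ 2)⁻¹ := by
      have h2 := Real.quadratic_le_exp_of_nonneg hz0.le
      rw [← div_eq_mul_inv, inv_le_comm₀ hr0 (by positivity), inv_div, hrz]
      linarith
    have hcub : C / r ^ 3 ≤ 1 / r ^ 2 * (2 * C * (z ^ 2)⁻¹) := by
      calc C / r ^ 3 = 1 / r ^ 2 * (C * r⁻¹) := by field_simp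
        _ ≤ 1 / r ^ 2 * (C * (2 * (z ^ 2)⁻¹)) := by gcongr
        _ = 1 / r ^ 2 * (2 * C * (z ^ 2)⁻¹) := by ring
    have hAsq : logRateDeriv s ε' z ^ 2 ≤ (s : ℝ) ^ 2 / 2 * (z ^ 2)⁻¹ + 2 * ε' * D := by
      have h2 := pow_le_pow_left₀ (logRateDeriv_nonneg hε'0 h1) (logRateDeriv_le h1) 2
      have h3 : (s / 2 * z⁻¹ + ε' * D) ^ 2 ≤ 2 * (s / 2 * z⁻¹) ^ 2 + 2 * (ε' * D) ^ 2 := by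
        linarith [sq_nonneg (s / 2 * z⁻¹ - ε' * D)]
      have h4 : 2 * (s / 2 * z⁻¹) ^ 2 = (s : ℝ) ^ 2 / 2 * (z ^ 2)⁻¹ := by
        rw [← inv_pow]
        ring
      have h5 : (ε' * D) ^ 2 ≤ ε' * D :=
        pow_le_of_le_one (by positivity) (mul_le_one₀ hε'1 hD0.le hD1) two_ne_zero
      linarith
    have hrest : ((s : ℝ) ^ 2 / 2 + 3 * C) * (z ^ 2)⁻¹ ≤ ε / 2 * D := by
      calc ((s : ℝ) ^ 2 / 2 + 3 * C) * (z ^ 2)⁻¹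
          ≤ ((s : ℝ) ^ 2 / 2 + 3 * C + 1) * (κ * D) :=
            mul_le_mul (by linarith) hκz (by positivity) hden.le
        _ = ε / 2 * D := by
            rw [hκ]
            field_simp
    have hεD : 4 * ε' * D ≤ ε / 2 * D := mul_le_mul_of_nonneg_right (by linarith) hD0.le
    refine (add_le_add_right hcub _).trans ?_
    rw [← mul_add]
    refine mul_le_mul_of_nonneg_left ?_ (by positivity)
    have h2A : 2 * logRateDeriv s ε' z = ∑ j ∈ Finset.Icc 1 s, iterLogDeriv j z + 2 * ε' * D := by
      rw [logRateDeriv, ← hD]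
      ring
    linarith
  obtain ⟨N, hN⟩ := eventually_atTop.1 (Real.tendsto_log_atTop.eventually hev)
  exact ⟨ε', hε'0, N, fun n hn => hN _ hn n rfl⟩

end Laplacian

end LatticeSchrodinger

end

theorem theorem3p4 (d : ℕ) (hd : 1 ≤ d) (V : (Fin d → ℤ) → ℝ)
    (hspec : LatticeSchrodinger.HasInf
      (LatticeSchrodinger.opSpectrum (LatticeSchrodinger.schrodinger V)) 0)
    (hess : LatticeSchrodinger.HasInf
      (LatticeSchrodinger.essSpectrum (LatticeSchrodinger.schrodinger V)) 0)
    (hcrit : LatticeSchrodinger.IsCriticalAt V 0) :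
    ((∃ (s : ℕ) (ε : ℝ), 0 < ε ∧ ∃ N : ℝ, ∀ n : Fin d → ℤ,
        N ≤ LatticeSchrodinger.latticeNorm n →
          LatticeSchrodinger.generalBound s ε n ≤ V n) →
      (0 : ℂ) ∈ LatticeSchrodinger.pointSpectrum (LatticeSchrodinger.schrodinger V)) ∧
    ((∃ (s : ℕ) (ε : ℝ), 0 < ε ∧ ∃ N : ℝ, ∀ n : Fin d → ℤ,
        N ≤ LatticeSchrodinger.latticeNorm n →
          LatticeSchrodinger.explicitBound s ε n ≤ V n) →
      (0 : ℂ) ∈ LatticeSchrodinger.pointSpectrum (LatticeSchrodinger.schrodinger V)) := by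
  refine ⟨?_, ?_⟩
  · rintro ⟨s, ε, hε, N, hV⟩
    exact hcrit.zero_mem_pointSpectrum_of_generalBound hε hV
  · rintro ⟨s, ε, hε, N, hV⟩
    obtain ⟨ε', hε', N', hle⟩ :=
      LatticeSchrodinger.exists_generalBound_le_explicitBound (d := d) s hε
    exact hcrit.zero_mem_pointSpectrum_of_generalBound hε' (N := max N N') fun n hn =>
      (hle n ((le_max_right _ _).trans hn)).trans (hV n ((le_max_left _ _).trans hn))
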